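/- For a finite field $F$ and an integer $d\ge 2$ let $P=\{(x,x\cdot x): x\in F^{d-1}\}\subset F^d$ be the paraboloid. Let $e$ be a nontrivial additive character of $F$, and for $f:P\to\mathbb C$ put $(f\,d\sigma)^\vee(x)=\frac1{|P|}\sum_{\xi\in P} f(\xi)\,e(x\cdot\xi)$, $x\in F^d$. For $1\le p,r<\infty$ let $R^*(p\to r)$ be the best constant in the inequality $$\Big(\sum_{x\in F^d}|(f\,d\sigma)^\vee(x)|^r\Big)^{1/r}\le R^*(p\to r)\Big(\frac1{|P|}\sum_{\xi\in P}|f(\xi)|^p\Big)^{1/p}\qquad\text{for all } f:P\to\mathbb C.$$ Then, for all finite fields $F$ of odd characteristic and all nontrivial additive characters $e$ of $F$: (i) if $d=4$, then $R^*(2\to \tfrac{28}{9})\le C$ for an absolute constant $C$; (ii) if $d=6$, then for every $\varepsilon>0$, $R^*(2\to \tfrac83+\varepsilon)\le C_\varepsilon$, where $C_\varepsilon$ depends only on $\varepsilon$; (iii) if $d\ge 8$ is even, then $R^*(2\to\tfrac{2d+4}{d})\le C_d$, where $C_d$ depends only on $d$. In particular, none of the constants depends on $F$ or on $e$. -/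

import Mathlib

open scoped NNReal ENNReal

noncomputable section

namespace FiniteFieldRestriction

/-- The paraboloid `{(x, x ⬝ x) : x ∈ F ^ n}` in `F ^ (n + 1)`, the ambient dimension being
`d = n + 1`. -/
def paraboloid (F : Type*) [Field F] [Fintype F] (n : ℕ) : Finset (Fin (n + 1) → F) :=
  open Classical in
  Finset.univ.image fun x : Fin n → F => Fin.snoc (α := fun _ => F) x (x ⬝ᵥ x)

/-- The extension operator `(f dσ)^∨ (x) = |P|⁻¹ ∑_{ξ ∈ P} f(ξ) e(x ⬝ ξ)` of the paraboloid. -/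
def extensionOp {F : Type*} [Field F] [Fintype F] (e : AddChar F ℂ) {n : ℕ}
    (f : paraboloid F n → ℂ) (x : Fin (n + 1) → F) : ℂ :=
  ((paraboloid F n).card : ℂ)⁻¹ * ∑ ξ : paraboloid F n, f ξ * e (x ⬝ᵥ ξ.1)

/-- The `L^r` norm with respect to counting measure. -/
def countingNorm {X : Type*} [Fintype X] (r : ℝ) (g : X → ℂ) : ℝ :=
  (∑ x, ‖g x‖ ^ r) ^ (1 / r)

/-- The `L^p(P, dσ)` norm, where `dσ` is the normalized counting measure on the paraboloid. -/
def surfaceNorm {F : Type*} [Field F] [Fintype F] {n : ℕ} (p : ℝ)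
    (f : paraboloid F n → ℂ) : ℝ :=
  (((paraboloid F n).card : ℝ)⁻¹ * ∑ ξ : paraboloid F n, ‖f ξ‖ ^ p) ^ (1 / p)

/-- `R*(p → r)` for the paraboloid in `F ^ (n + 1)` and the additive character `e`: the best
constant `C` with `‖(f dσ)^∨‖_{L^r} ≤ C ‖f‖_{L^p(P, dσ)}` for all `f : P → ℂ`
(it would be `∞` if there were no such constant). -/
def extensionConst {F : Type*} [Field F] [Fintype F] (e : AddChar F ℂ) (n : ℕ) (p r : ℝ) : ℝ≥0∞ :=
  ⨅ (C : ℝ≥0) (_ : ∀ f : paraboloid F n → ℂ,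
    countingNorm r (extensionOp e f) ≤ C * surfaceNorm p f), (C : ℝ≥0∞)

end FiniteFieldRestriction

end

namespace FiniteFieldRestriction

open Finset

/-! Write `q = |F|` and `n = d - 1 = 2k + 1`. For `f` of norm one, let `G` be the set of `N` points
where the extension has size about `L`. Duality gives `q^n (L N)^2 ≤ R(G)`, where `R(G)` is the
restriction energy of a function bounded by 1 on `G`. Upper bounds for `R(G)` therefore limit `N` in
terms of `L`, and the dyadic values of `L` are then summed.

Plancherel gives `R(G) ≤ q^(n+1) N`, and Stein–Tomas gives `R(G) ≤ q^n N + q^(n/2) N^2`. The main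
input is a slicing bound, `restrictionEnergy_le_slices`. Expand `R(G)` over pairs of points.
Distinct points at equal height are orthogonal. For a fixed height `a`, completing the square turns
the interaction of that slice with a point `y` at another height into a Gauss factor times the
extension of a function on the slice, evaluated at a point depending injectively on `y`. Hölder's
inequality in `y` leaves a fourth moment, which counts additive quadruples on the paraboloid, that
is, right-angled corners in the slice (`fourth_moment_le`).

A set `E ⊂ F^n` has at most a constant times `|E|^3/q + q^k |E|^2` corners (`card_corners_le`). If
the side `z - y` is not isotropic, inversion about `y` turns the right angle at `z` into an
incidence `x ⬝ w = 1`, controlled by a variance computation. Isotropic sides are counted with Gauss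
sums; since `n` is odd, a single Gauss sum survives the square-root evaluation, and averaging it
against a character gains a factor.

Up to constants the outcome is `L^2 N ≤ 1`, or `q^k L^4 N ≤ 1`, or `q^k L^8 N^3 ≤ q^2`, always with
`L^2 N ≤ q`. Both nontrivial cases balance against Plancherel at `L = q^(-(k+1)/2)`, which yields
the exponent `2 + 2/(k+1) = (2d+4)/d`. The third case carries `L^(r - 8/3)`: it decays away from the
balance point for `k ≥ 3`, is scale invariant at the endpoint for `k = 2` (hence the `ε`), and for
`k = 1` needs Stein–Tomas to bound `L` from above. -/

theorem char_sum_eq_prod {R ι : Type*} [AddCommMonoid R] (e : AddChar R ℂ) (s : Finset ι)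
    (f : ι → R) :
    e (∑ i ∈ s, f i) = ∏ i ∈ s, e (f i) := by
  classical
  induction s using Finset.induction_on with
  | empty => simp
  | insert a s ha ih => rw [sum_insert ha, prod_insert ha, AddChar.map_add_eq_mul, ih]

/-! ### Orthogonality and quadratic Gauss sums -/

section CharacterSums

variable {F : Type*} [Field F] [Fintype F] {e : AddChar F ℂ}

/-- Orthogonality of the characters of `F ^ m`. -/
theorem sum_char_dotProduct [DecidableEq F] (he : e ≠ 1) {m : ℕ} (y : Fin m → F) :
    ∑ x : Fin m → F, e (x ⬝ᵥ y) = if y = 0 then (Fintype.card F : ℂ) ^ m else 0 := by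
  have h1 : ∀ x : Fin m → F, e (x ⬝ᵥ y) = ∏ i, e (x i * y i) := fun x => by
    simp only [dotProduct, char_sum_eq_prod]
  simp_rw [h1]
  rw [← Fintype.prod_sum fun i a => e (a * y i)]
  simp_rw [AddChar.sum_mulShift _ (AddChar.IsPrimitive.of_ne_one he)]
  split_ifs with h
  · simp [h]
  · obtain ⟨i, hi⟩ := Function.ne_iff.mp h
    exact prod_eq_zero (mem_univ i) (by simpa using hi)

theorem normSq_sum_eq {X : Type*} (A : Finset X) (c : X → ℂ) :
    ((‖∑ x ∈ A, c x‖ ^ 2 : ℝ) : ℂ) = ∑ p ∈ A ×ˢ A, c p.1 * (starRingEnd ℂ) (c p.2) := by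
  rw [Complex.ofReal_pow, ← Complex.mul_conj', map_sum, sum_mul_sum, sum_product]

/-- The large sieve form of Plancherel's theorem, for frequencies `h x` that may coincide. -/
theorem sum_norm_sq_charSum_le [DecidableEq F] (he : e ≠ 1) {m : ℕ} {X : Type*} (A : Finset X)
    (g : X → ℂ) (hg : ∀ x ∈ A, ‖g x‖ ≤ 1) (h : X → Fin m → F) :
    ∑ v : Fin m → F, ‖∑ x ∈ A, g x * e (v ⬝ᵥ h x)‖ ^ 2 ≤
      (Fintype.card F : ℝ) ^ m * #{p ∈ A ×ˢ A | h p.1 = h p.2} := by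
  have h1 : ((∑ v : Fin m → F, ‖∑ x ∈ A, g x * e (v ⬝ᵥ h x)‖ ^ 2 : ℝ) : ℂ) =
      ∑ p ∈ A ×ˢ A, g p.1 * (starRingEnd ℂ) (g p.2) *
        if h p.1 = h p.2 then (Fintype.card F : ℂ) ^ m else 0 := by
    rw [Complex.ofReal_sum]
    simp_rw [normSq_sum_eq]
    rw [sum_comm]
    refine sum_congr rfl fun p _ => ?_
    simp only [← sub_eq_zero (a := h p.1)]
    rw [← sum_char_dotProduct he, mul_sum]
    refine sum_congr rfl fun v _ => ?_
    rw [map_mul, ← AddChar.map_neg_eq_conj, dotProduct_sub, sub_eq_add_neg, AddChar.map_add_eq_mul]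
    ring
  have h2 : ∑ v : Fin m → F, ‖∑ x ∈ A, g x * e (v ⬝ᵥ h x)‖ ^ 2 =
      ‖((∑ v : Fin m → F, ‖∑ x ∈ A, g x * e (v ⬝ᵥ h x)‖ ^ 2 : ℝ) : ℂ)‖ := by
    rw [Complex.norm_real, Real.norm_of_nonneg (by positivity)]
  rw [h2, h1, card_filter, Nat.cast_sum, mul_sum]
  refine (norm_sum_le _ _).trans (sum_le_sum fun p hp => ?_)
  rw [mem_product] at hp
  rw [norm_mul, norm_mul, RCLike.norm_conj]
  have h3 : ‖g p.1‖ * ‖g p.2‖ ≤ 1 := mul_le_one₀ (hg _ hp.1) (norm_nonneg _) (hg _ hp.2)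
  split_ifs
  · simp only [norm_pow, Complex.norm_natCast, Nat.cast_one, mul_one]
    exact mul_le_of_le_one_left (by positivity) h3
  · simp

/-- The quadratic Gauss sum `∑ₓ e(t x²)`. -/
def quadGaussSum (e : AddChar F ℂ) (t : F) : ℂ := ∑ x, e (t * x ^ 2)

/-- Since `u` has `χ u + 1` square roots, the sum is the Gauss sum of the quadratic character `χ`
for the dilated additive character. Its square is `χ(-1) q`, in which `t` no longer appears; this
uniformity in `t` is what the isotropic count needs. -/
theorem quadGaussSum_sq (hF : ringChar F ≠ 2) (he : e ≠ 1) :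
    ∃ s : ℂ, ‖s‖ = Fintype.card F ∧ ∀ t ≠ 0, quadGaussSum e t ^ 2 = s := by
  classical
  let χ : MulChar F ℂ := (quadraticChar F).ringHomComp (Int.castRingHom ℂ)
  have hinj : Function.Injective (Int.castRingHom ℂ) := (Int.castRingHom ℂ).injective_int
  have hχ : χ ≠ 1 := (MulChar.ringHomComp_ne_one_iff hinj).2 (quadraticChar_ne_one hF)
  have hχ2 : χ.IsQuadratic := (quadraticChar_isQuadratic F).comp _
  refine ⟨χ (-1) * Fintype.card F, ?_, fun t ht => ?_⟩
  · rcases hχ2 (-1) with h | h | h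
    · exact absurd h ((isUnit_one.neg).map χ).ne_zero
    · simp [h]
    · simp [h]
  · have hp : (AddChar.mulShift e t).IsPrimitive :=
      AddChar.IsPrimitive.of_ne_one (AddChar.IsPrimitive.of_ne_one he ht)
    rw [← gaussSum_sq hχ hχ2 hp]
    congr 1
    have h1 : quadGaussSum e t = ∑ u, (#{x : F | x ^ 2 = u} : ℂ) * e (t * u) := by
      rw [quadGaussSum, ← sum_fiberwise (s := univ) (g := fun x : F => x ^ 2)]
      refine sum_congr rfl fun u _ => ?_
      rw [sum_congr rfl (g := fun _ => e (t * u))]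
      · simp
      · intro x hx
        rw [(mem_filter.1 hx).2]
    have h2 : ∀ u : F, (#{x : F | x ^ 2 = u} : ℂ) = χ u + 1 := fun u => by
      have := quadraticChar_card_sqrts hF u
      rw [Set.toFinset_ofPred] at this
      have h3 : (#{x : F | x ^ 2 = u} : ℂ) = ((#{x : F | x ^ 2 = u} : ℤ) : ℂ) := by simp
      rw [h3, this]
      simp [χ]
    have h4 : ∑ u, e (t * u) = 0 := by
      have := AddChar.sum_mulShift (R := F) t (AddChar.IsPrimitive.of_ne_one he)
      simpa [ht, mul_comm] using this
    simp_rw [h1, h2, add_mul, one_mul, sum_add_distrib, h4, add_zero]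
    rfl

theorem norm_quadGaussSum_sq (hF : ringChar F ≠ 2) (he : e ≠ 1) {t : F} (ht : t ≠ 0) :
    ‖quadGaussSum e t‖ ^ 2 = Fintype.card F := by
  obtain ⟨s, hs, h⟩ := quadGaussSum_sq hF he
  rw [← norm_pow, h t ht, hs]

theorem conj_quadGaussSum (t : F) : (starRingEnd ℂ) (quadGaussSum e t) = quadGaussSum e (-t) := by
  simp_rw [quadGaussSum, map_sum, ← AddChar.map_neg_eq_conj, neg_mul]

/-- The Fourier transform of a quadratic phase, by completing the square. -/
theorem sum_char_quadratic (hF : ringChar F ≠ 2) {n : ℕ} {t : F} (ht : t ≠ 0)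
    (y : Fin n → F) :
    ∑ x : Fin n → F, e (t * (x ⬝ᵥ x) + x ⬝ᵥ y) =
      e (-(y ⬝ᵥ y) / (4 * t)) * quadGaussSum e t ^ n := by
  have h2 : (2 : F) ≠ 0 := Ring.two_ne_zero hF
  have h4 : (4 : F) ≠ 0 := by
    have : (4 : F) = 2 * 2 := by norm_num
    rw [this]; exact mul_ne_zero h2 h2
  have h1 : ∀ x : Fin n → F, e (t * (x ⬝ᵥ x) + x ⬝ᵥ y) =
      e (-(y ⬝ᵥ y) / (4 * t)) * ∏ i, e (t * (x i + y i / (2 * t)) ^ 2) := fun x => by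
    have h3 : ∏ i, e (t * (x i + y i / (2 * t)) ^ 2) =
        e (∑ i, t * (x i + y i / (2 * t)) ^ 2) := (char_sum_eq_prod _ _ _).symm
    rw [h3, ← AddChar.map_add_eq_mul]
    congr 1
    simp only [dotProduct, mul_sum, neg_div, sum_div]
    rw [← sum_neg_distrib, ← sum_add_distrib, ← sum_add_distrib]
    refine sum_congr rfl fun i _ => ?_
    field_simp
    ring
  simp_rw [h1]
  rw [← mul_sum, ← Fintype.prod_sum fun i a => e (t * (a + y i / (2 * t)) ^ 2)]
  have h5 : ∀ i, ∑ a, e (t * (a + y i / (2 * t)) ^ 2) = quadGaussSum e t := fun i =>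
    Fintype.sum_equiv (Equiv.addRight (y i / (2 * t))) _ _ fun a => rfl
  simp_rw [h5]
  simp

theorem card_filter_sq_eq_le_two [DecidableEq F] (c : F) : #{x : F | x ^ 2 = c} ≤ 2 := by
  by_cases h : ∃ a : F, a ^ 2 = c
  · obtain ⟨a, rfl⟩ := h
    refine (card_le_card (t := {a, -a}) fun x hx => ?_).trans card_le_two
    simpa [sq_eq_sq_iff_eq_or_eq_neg] using hx
  · push Not at h
    simp [filter_eq_empty_iff.2 fun x _ => h x]

/-- Averaging the quadratic Gauss sums against a character counts square roots. -/
theorem norm_sum_quadGaussSum_mul_char_le (he : e ≠ 1) (c : F) [DecidableEq F] :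
    ‖∑ t ∈ univ.erase (0 : F), quadGaussSum e (-t) * e (t * c)‖ ≤ Fintype.card F := by
  have h1 : ∑ t ∈ univ.erase (0 : F), quadGaussSum e (-t) * e (t * c) =
      (Fintype.card F : ℂ) * (#{x : F | x ^ 2 = c} - 1) := by
    have h2 : ∑ t, quadGaussSum e (-t) * e (t * c) =
        (Fintype.card F : ℂ) * #{x : F | x ^ 2 = c} := by
      simp_rw [quadGaussSum, sum_mul]
      rw [sum_comm, card_filter, Nat.cast_sum, mul_sum]
      refine sum_congr rfl fun x _ => ?_
      have h3 : ∀ t : F, e (-t * x ^ 2) * e (t * c) = e (t * (c - x ^ 2)) := fun t => by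
        rw [← AddChar.map_add_eq_mul]
        congr 1
        ring
      simp_rw [h3, AddChar.sum_mulShift _ (AddChar.IsPrimitive.of_ne_one he), sub_eq_zero,
        eq_comm (a := c)]
      split_ifs <;> simp
    rw [← sum_erase_add univ _ (mem_univ (0 : F))] at h2
    simp only [neg_zero, zero_mul, AddChar.map_zero_eq_one, mul_one] at h2
    have h4 : quadGaussSum e 0 = Fintype.card F := by simp [quadGaussSum]
    rw [h4] at h2
    linear_combination h2
  rw [h1, norm_mul, Complex.norm_natCast]
  refine mul_le_of_le_one_right (by positivity) ?_
  have h5 := card_filter_sq_eq_le_two c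
  interval_cases #{x : F | x ^ 2 = c} <;> norm_num

end CharacterSums

/-! ### Counting right-angled corners -/

section AdditiveEnergy

variable {F : Type*} [Field F] [Fintype F] [DecidableEq F] {e : AddChar F ℂ}

theorem card_diag_filter_le {X Y : Type*} [DecidableEq X] [DecidableEq Y] (A : Finset X) (h : X → Y)
    (hh : Set.InjOn h A) : #{p ∈ A ×ˢ A | h p.1 = h p.2} ≤ #A := by
  refine card_le_card_of_injOn Prod.fst (fun p hp => ?_) fun p hp r hr hpr => ?_
  · simp only [coe_filter, mem_product, Set.mem_ofPred_eq] at hp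
    exact hp.1.1
  · simp only [coe_filter, mem_product, Set.mem_ofPred_eq] at hp hr
    refine Prod.ext hpr ?_
    rw [← hh hp.1.1 hp.1.2 hp.2, ← hh hr.1.1 hr.1.2 hr.2, hpr]

/-- In odd dimension the pairs at distance zero are equidistributed, with square root error. -/
theorem card_isotropic_pairs_le (hF : ringChar F ≠ 2) (he : e ≠ 1) {n k : ℕ} (hn : n = 2 * k + 1)
    (E : Finset (Fin n → F)) :
    (#{p ∈ E ×ˢ E | (p.1 - p.2) ⬝ᵥ (p.1 - p.2) = 0} : ℝ) ≤
      (#E : ℝ) ^ 2 / Fintype.card F + (Fintype.card F : ℝ) ^ k * #E := by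
  have h2 : (2 : F) ≠ 0 := Ring.two_ne_zero hF
  have h4 : (4 : F) ≠ 0 := by
    have : (4 : F) = 2 * 2 := by norm_num
    rw [this]; exact mul_ne_zero h2 h2
  have hq : (0 : ℝ) < Fintype.card F := by exact_mod_cast Fintype.card_pos
  set Z := #{p ∈ E ×ˢ E | (p.1 - p.2) ⬝ᵥ (p.1 - p.2) = 0} with hZ
  let Q : (Fin n → F) × (Fin n → F) → F := fun p => (p.1 - p.2) ⬝ᵥ (p.1 - p.2)
  let T : ℂ := ∑ t ∈ univ.erase (0 : F), ∑ p ∈ E ×ˢ E, e (t * Q p)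
  have hT : (Fintype.card F : ℂ) * Z = (#E : ℂ) ^ 2 + T := by
    have h1 : ∑ t : F, ∑ p ∈ E ×ˢ E, e (t * Q p) = (Fintype.card F : ℂ) * Z := by
      rw [sum_comm, hZ, card_filter, Nat.cast_sum, mul_sum]
      refine sum_congr rfl fun p _ => ?_
      rw [AddChar.sum_mulShift _ (AddChar.IsPrimitive.of_ne_one he)]
      simp only [Q]
      split_ifs <;> simp
    rw [← h1, ← sum_erase_add univ _ (mem_univ (0 : F)), add_comm]
    simp [T, sq]
  obtain ⟨σ, hσ, hS⟩ := quadGaussSum_sq hF he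
  have hT2 : (Fintype.card F : ℂ) ^ n * T = σ ^ k * ∑ m : Fin n → F,
      (∑ s ∈ univ.erase (0 : F), quadGaussSum e (-s) * e (s * (m ⬝ᵥ m))) *
        ((‖∑ x ∈ E, 1 * e (m ⬝ᵥ x)‖ ^ 2 : ℝ) : ℂ) := by
    -- The involution `t = -1/(4s)` puts the phase in the form produced by completing the square, so
    -- that it can be written as a Fourier transform.
    have h1 : T = ∑ s ∈ univ.erase (0 : F), ∑ p ∈ E ×ˢ E, e (-Q p / (4 * s)) := by
      have hinv : ∀ t ∈ univ.erase (0 : F), -1 / (4 * t) ∈ univ.erase (0 : F) := fun t ht => by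
        simp only [mem_erase, mem_univ, and_true] at ht ⊢
        exact div_ne_zero (by simp) (mul_ne_zero h4 ht)
      refine sum_nbij' (fun t => -1 / (4 * t)) (fun t => -1 / (4 * t)) hinv hinv ?_ ?_ ?_
      · intro t ht
        have := ne_of_mem_erase ht
        field_simp
      · intro t ht
        have := ne_of_mem_erase ht
        field_simp
      · intro t ht
        have := ne_of_mem_erase ht
        refine sum_congr rfl fun p _ => ?_
        congr 1
        field_simp
    have h3 : ∀ s ∈ univ.erase (0 : F), ∀ p : (Fin n → F) × (Fin n → F),
        (Fintype.card F : ℂ) ^ n * e (-Q p / (4 * s)) =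
          σ ^ k * ∑ m : Fin n → F, quadGaussSum e (-s) * e (s * (m ⬝ᵥ m)) *
            e (m ⬝ᵥ (p.1 - p.2)) := by
      intro s hs p
      have hs0 := ne_of_mem_erase hs
      have h5 : (Fintype.card F : ℂ) = quadGaussSum e s * quadGaussSum e (-s) := by
        rw [← conj_quadGaussSum, Complex.mul_conj', ← Complex.ofReal_pow,
          norm_quadGaussSum_sq hF he hs0]
        simp
      -- Oddness of `n` enters here: one Gauss sum depending on `s` remains, and the sum over `s`
      -- then counts square roots instead of being bounded termwise.
      have h6 : quadGaussSum e (-s) ^ n = σ ^ k * quadGaussSum e (-s) := by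
        rw [hn, pow_succ, pow_mul, hS _ (neg_ne_zero.2 hs0)]
      have h7 := sum_char_quadratic hF hs0 (e := e) (p.1 - p.2)
      rw [h5, mul_pow, h6]
      have h8 : ∀ m : Fin n → F, quadGaussSum e (-s) * e (s * (m ⬝ᵥ m)) *
          e (m ⬝ᵥ (p.1 - p.2)) = quadGaussSum e (-s) * e (s * (m ⬝ᵥ m) + m ⬝ᵥ (p.1 - p.2)) :=
        fun m => by rw [AddChar.map_add_eq_mul, mul_assoc]
      simp_rw [h8, ← mul_sum]
      rw [h7]
      simp only [Q]
      ring
    have h9 : ∀ m : Fin n → F, ((‖∑ x ∈ E, 1 * e (m ⬝ᵥ x)‖ ^ 2 : ℝ) : ℂ) =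
        ∑ p ∈ E ×ˢ E, e (m ⬝ᵥ (p.1 - p.2)) := fun m => by
      rw [normSq_sum_eq]
      refine sum_congr rfl fun p _ => ?_
      rw [one_mul, one_mul, ← AddChar.map_neg_eq_conj, ← AddChar.map_add_eq_mul, dotProduct_sub,
        sub_eq_add_neg]
    rw [h1, mul_sum]
    simp_rw [mul_sum (E ×ˢ E)]
    rw [sum_congr rfl fun s hs => sum_congr rfl fun p _ => h3 s hs p]
    simp_rw [h9, ← mul_sum]
    congr 1
    simp_rw [sum_mul, mul_sum]
    rw [sum_congr rfl fun s _ => sum_comm]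
    rw [sum_comm]
  have hT3 : (Fintype.card F : ℝ) ^ n * ‖T‖ ≤
      (Fintype.card F : ℝ) ^ n * ((Fintype.card F : ℝ) * ((Fintype.card F : ℝ) ^ k * #E)) := by
    have h1 : (Fintype.card F : ℝ) ^ n * ‖T‖ = ‖(Fintype.card F : ℂ) ^ n * T‖ := by
      simp
    rw [h1, hT2, norm_mul, norm_pow, hσ]
    calc _ ≤ (Fintype.card F : ℝ) ^ k * ∑ m : Fin n → F,
          (Fintype.card F : ℝ) * ‖∑ x ∈ E, 1 * e (m ⬝ᵥ x)‖ ^ 2 := by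
          gcongr
          refine norm_sum_le_of_le _ fun m _ => ?_
          rw [norm_mul, Complex.norm_real, Real.norm_of_nonneg (by positivity)]
          gcongr
          exact norm_sum_quadGaussSum_mul_char_le he _
      _ ≤ (Fintype.card F : ℝ) ^ k *
          ((Fintype.card F : ℝ) * ((Fintype.card F : ℝ) ^ n * #E)) := by
          rw [← mul_sum]
          gcongr
          refine (sum_norm_sq_charSum_le he E (fun _ => 1) (by simp) (fun x => x)).trans ?_
          gcongr
          exact_mod_cast card_diag_filter_le E (fun x => x) (fun _ _ _ _ h => h)
      _ = _ := by ring
  have hT4 := le_of_mul_le_mul_left hT3 (by positivity)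
  have h10 : (Fintype.card F : ℝ) * Z ≤ (#E : ℝ) ^ 2 + ‖T‖ := by
    have : (Fintype.card F : ℝ) * Z = ‖(Fintype.card F : ℂ) * Z‖ := by simp
    rw [this, hT]
    refine (norm_add_le _ _).trans (by simp)
  rw [← mul_le_mul_iff_right₀ hq]
  calc _ ≤ _ := h10
    _ ≤ _ := add_le_add_right hT4 _
    _ = _ := by field_simp

theorem card_hyperplane {n : ℕ} {x : Fin (n + 1) → F} (hx : x ≠ 0) :
    #{w : Fin (n + 1) → F | x ⬝ᵥ w = 1} = Fintype.card F ^ n := by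
  obtain ⟨i, hi⟩ := Function.ne_iff.mp hx
  simp only [Pi.zero_apply] at hi
  set v : Fin (n + 1) → F := Pi.single i (x i)⁻¹
  have hv : x ⬝ᵥ v = 1 := by simp [v, hi]
  have hle : #((univ : Finset F) ×ˢ ({w : Fin (n + 1) → F | x ⬝ᵥ w = 1} : Finset _)) =
      #(univ : Finset (Fin (n + 1) → F)) := by
    refine card_nbij' (fun p => p.2 + (p.1 - 1) • v) (fun w => (x ⬝ᵥ w, w + (1 - x ⬝ᵥ w) • v))
      (by simp) ?_ ?_ ?_
    · intro w _
      simp [hv]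
    · intro p hp
      simp only [coe_product, coe_univ, coe_filter, Set.mem_prod, Set.mem_univ, mem_univ,
        true_and, Set.mem_ofPred_eq] at hp
      refine Prod.ext ?_ ?_
      · simp [hv, hp]
      · simp only [dotProduct_add, dotProduct_smul, hp, hv, smul_eq_mul, mul_one]
        rw [add_assoc, ← add_smul]
        simp
    · intro w _
      simp only
      rw [add_assoc, ← add_smul]
      simp
  rw [card_product, card_univ, card_univ, Fintype.card_fun, Fintype.card_fin, pow_succ',
    Nat.mul_right_inj Fintype.card_ne_zero] at hle
  exact hle

/-- Given one solution `w₀`, translating the solutions along `w₀` and along some `v` with `(x - y) ⬝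
v = 1` gives disjoint copies indexed by `F × F`. If `x` and `y` are proportional there is no
solution at all. -/
theorem card_inter_hyperplanes_le {n : ℕ} {x y : Fin n → F} (hxy : x ≠ y) :
    Fintype.card F ^ 2 * #{w : Fin n → F | x ⬝ᵥ w = 1 ∧ y ⬝ᵥ w = 1} ≤ Fintype.card F ^ n := by
  rcases ({w : Fin n → F | x ⬝ᵥ w = 1 ∧ y ⬝ᵥ w = 1} : Finset _).eq_empty_or_nonempty with h | ⟨w₀, h⟩
  · simp [h]
  simp only [mem_filter, mem_univ, true_and] at h
  obtain ⟨i, hi⟩ := Function.ne_iff.mp (sub_ne_zero.2 hxy)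
  simp only [Pi.zero_apply] at hi
  set v : Fin n → F := Pi.single i ((x - y) i)⁻¹
  have hv : (x - y) ⬝ᵥ v = 1 := by
    rw [dotProduct_single]
    exact mul_inv_cancel₀ hi
  have hle : #((univ : Finset (F × F)) ×ˢ
      ({w : Fin n → F | x ⬝ᵥ w = 1 ∧ y ⬝ᵥ w = 1} : Finset _)) ≤
      #(univ : Finset (Fin n → F)) := by
    refine card_le_card_of_injOn (fun p => p.2 + p.1.1 • w₀ + p.1.2 • v) (by simp) ?_
    rintro ⟨⟨s, t⟩, w⟩ hp ⟨⟨s', t'⟩, w'⟩ hp' heq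
    simp only [coe_product, coe_univ, coe_filter, Set.mem_prod, Set.mem_univ, mem_univ,
      true_and, Set.mem_ofPred_eq] at hp hp' heq
    have hw : ∀ w : Fin n → F, x ⬝ᵥ w = 1 ∧ y ⬝ᵥ w = 1 → (x - y) ⬝ᵥ w = 0 := fun w hw => by
      rw [sub_dotProduct, hw.1, hw.2, sub_self]
    have ht : t = t' := by
      have := congrArg ((x - y) ⬝ᵥ ·) heq
      simpa [hw w hp, hw w' hp', hw w₀ h, hv] using this
    subst ht
    have hs : s = s' := by
      have := congrArg (x ⬝ᵥ ·) heq
      simpa [hp.1, hp'.1, h.1] using this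
    subst hs
    simpa using heq
  rw [card_product, card_univ, card_univ, Fintype.card_prod, Fintype.card_fun, Fintype.card_fin,
    ← sq] at hle
  exact hle

/-- The number of solutions of `x ⬝ w = 1` in `A × B`. -/
theorem card_dotProduct_eq_one_le {n : ℕ} (A B : Finset (Fin (n + 1) → F)) :
    (#{p ∈ A ×ˢ B | p.1 ⬝ᵥ p.2 = 1} : ℝ) ≤
      (#A : ℝ) * #B / Fintype.card F + √((Fintype.card F : ℝ) ^ n * #A * #B) := by
  have hq : (0 : ℝ) < Fintype.card F := by exact_mod_cast Fintype.card_pos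
  set q : ℝ := (Fintype.card F : ℝ) with hqdef
  -- The origin takes part in no solution, and every other `x` defines a hyperplane with exactly
  -- `q^n` points.
  set A' := A.erase 0 with hA'
  let N : (Fin (n + 1) → F) → ℝ := fun w => ∑ x ∈ A', if x ⬝ᵥ w = 1 then 1 else 0
  have hcount : (#{p ∈ A ×ˢ B | p.1 ⬝ᵥ p.2 = 1} : ℝ) = ∑ w ∈ B, N w := by
    rw [card_filter, sum_product_right, Nat.cast_sum]
    refine sum_congr rfl fun w _ => ?_
    simp only [N, hA']
    rw [sum_erase A (by simp)]
    push_cast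
    rfl
  have hsum : ∑ w, N w = #A' * q ^ n := by
    simp only [N]
    rw [sum_comm, sum_congr rfl (g := fun _ => q ^ n)]
    · simp
    · intro x hx
      rw [sum_boole, card_hyperplane (ne_of_mem_erase hx)]
      simp [hqdef]
  have hsq : q * ∑ w, N w ^ 2 ≤ #A' * q ^ (n + 1) + #A' * ((#A' : ℝ) - 1) * q ^ n := by
    have h1 : ∑ w, N w ^ 2 = ∑ x ∈ A', ∑ y ∈ A',
        (#{w : Fin (n + 1) → F | x ⬝ᵥ w = 1 ∧ y ⬝ᵥ w = 1} : ℝ) := by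
      simp only [N, sq, sum_mul_sum]
      rw [sum_comm]
      refine sum_congr rfl fun x _ => ?_
      rw [sum_comm]
      refine sum_congr rfl fun y _ => ?_
      rw [← sum_boole]
      refine sum_congr rfl fun w _ => ?_
      by_cases h1 : x ⬝ᵥ w = 1 <;> by_cases h2 : y ⬝ᵥ w = 1 <;> simp [h1, h2]
    rw [h1, mul_sum]
    have h2 : ∀ x ∈ A', q * ∑ y ∈ A', (#{w : Fin (n + 1) → F | x ⬝ᵥ w = 1 ∧ y ⬝ᵥ w = 1} : ℝ) ≤
        q ^ (n + 1) + ((#A' : ℝ) - 1) * q ^ n := by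
      intro x hx
      rw [← add_sum_erase _ _ hx, mul_add]
      have hc : ((#(A'.erase x) : ℕ) : ℝ) = #A' - 1 := by
        rw [card_erase_of_mem hx, Nat.cast_sub (card_pos.2 ⟨x, hx⟩), Nat.cast_one]
      refine add_le_add (le_of_eq ?_) ?_
      · simp only [and_self]
        rw [card_hyperplane (ne_of_mem_erase hx), pow_succ', hqdef]
        push_cast
        ring
      · rw [← hc, mul_sum, ← nsmul_eq_mul]
        refine sum_le_card_nsmul _ _ _ fun y hy => ?_
        have h3 : ((Fintype.card F ^ 2 *
            #{w : Fin (n + 1) → F | x ⬝ᵥ w = 1 ∧ y ⬝ᵥ w = 1} : ℕ) : ℝ) ≤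
            ((Fintype.card F ^ (n + 1) : ℕ) : ℝ) :=
          Nat.cast_le.2 (card_inter_hyperplanes_le (ne_of_mem_erase hy).symm)
        push_cast at h3
        rw [← mul_le_mul_iff_right₀ hq]
        calc _ = (Fintype.card F : ℝ) ^ 2 * _ := by rw [← mul_assoc, ← sq, hqdef]
          _ ≤ _ := h3
          _ = _ := by rw [pow_succ', hqdef]
    refine (sum_le_card_nsmul _ _ _ h2).trans (le_of_eq ?_)
    rw [nsmul_eq_mul]
    ring
  -- Pairs `x ≠ y` contribute no more than independence would predict, so the variance comes from
  -- the diagonal alone.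
  have hvar : ∑ w, (N w - #A' / q) ^ 2 ≤ q ^ n * #A' := by
    have h1 : ∑ w, (N w - #A' / q) ^ 2 =
        ∑ w, N w ^ 2 - 2 * (#A' / q) * ∑ w, N w + q ^ (n + 1) * (#A' / q) ^ 2 := by
      simp only [sub_sq, sum_add_distrib, sum_sub_distrib]
      congr 1
      · congr 1
        rw [mul_sum]
        exact sum_congr rfl fun w _ => by ring
      · simp [hqdef]
    rw [h1, hsum, ← mul_le_mul_iff_right₀ hq]
    have h3 : q * (∑ w, N w ^ 2 - 2 * (#A' / q) * (#A' * q ^ n) + q ^ (n + 1) * (#A' / q) ^ 2) =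
        q * ∑ w, N w ^ 2 - (#A' : ℝ) ^ 2 * q ^ n := by
      field_simp
      ring
    have h4 : (0 : ℝ) ≤ #A' * q ^ n := by positivity
    rw [h3]
    have h5 : (#A' : ℝ) * (#A' - 1) * q ^ n = (#A' : ℝ) ^ 2 * q ^ n - #A' * q ^ n := by ring
    have h6 : (#A' : ℝ) * q ^ (n + 1) = q * (q ^ n * #A') := by ring
    linarith
  have hAA : (#A' : ℝ) ≤ #A := by exact_mod_cast card_erase_le
  have hdev : ∑ w ∈ B, (N w - #A' / q) ≤ √(q ^ n * #A * #B) := by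
    refine Real.le_sqrt_of_sq_le ?_
    calc (∑ w ∈ B, (N w - #A' / q)) ^ 2 ≤ #B * ∑ w ∈ B, (N w - #A' / q) ^ 2 :=
          sq_sum_le_card_mul_sum_sq
      _ ≤ #B * (q ^ n * #A) := by
          gcongr
          refine (sum_le_sum_of_subset_of_nonneg (subset_univ B) fun w _ _ => sq_nonneg _).trans
            (hvar.trans ?_)
          gcongr
      _ = _ := by ring
  rw [sum_sub_distrib, sum_const, nsmul_eq_mul] at hdev
  rw [hcount]
  have h7 : (#B : ℝ) * (#A' / q) ≤ #A * #B / q := by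
    rw [mul_comm, div_mul_eq_mul_div]
    gcongr
  linarith

/-- Corners with a right angle at `z` for which `z - y` is not isotropic. -/
theorem card_right_angles_le {n k : ℕ} (hn : n = 2 * k + 1) (E : Finset (Fin n → F))
    (y : Fin n → F) :
    (#{p ∈ E ×ˢ E | (p.2 - y) ⬝ᵥ (p.2 - y) ≠ 0 ∧ (p.1 - p.2) ⬝ᵥ (y - p.2) = 0} : ℝ) ≤
      (#E : ℝ) ^ 2 / Fintype.card F + (Fintype.card F : ℝ) ^ k * #E := by
  subst hn
  -- Inversion about `y`. A right angle at `z` means `(x - y) ⬝ (z - y) = (z - y) ⬝ (z - y)`, hence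
  -- `(x - y) ⬝ inv z = 1`.
  let inv : (Fin (2 * k + 1) → F) → (Fin (2 * k + 1) → F) := fun z =>
    ((z - y) ⬝ᵥ (z - y))⁻¹ • (z - y)
  have hinj : ∀ z z', (z - y) ⬝ᵥ (z - y) ≠ 0 → (z' - y) ⬝ᵥ (z' - y) ≠ 0 →
      inv z = inv z' → z = z' := by
    have h : ∀ z, (z - y) ⬝ᵥ (z - y) ≠ 0 → z = y + (inv z ⬝ᵥ inv z)⁻¹ • inv z := fun z hz => by
      simp only [inv, dotProduct_smul, smul_dotProduct, smul_eq_mul, smul_smul]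
      have h1 : ∀ c : F, c ≠ 0 → (c⁻¹ * (c⁻¹ * c))⁻¹ * c⁻¹ = 1 := fun c hc => by field_simp
      rw [h1 _ hz, one_smul, add_sub_cancel]
    intro z z' hz hz' hzz
    rw [h z hz, h z' hz', hzz]
  have hle : #{p ∈ E ×ˢ E | (p.2 - y) ⬝ᵥ (p.2 - y) ≠ 0 ∧ (p.1 - p.2) ⬝ᵥ (y - p.2) = 0} ≤
      #{p ∈ E.image (· - y) ×ˢ E.image inv | p.1 ⬝ᵥ p.2 = 1} := by
    refine card_le_card_of_injOn (fun p => (p.1 - y, inv p.2)) ?_ ?_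
    · rintro ⟨x, z⟩ hp
      simp only [coe_filter, mem_product, Set.mem_ofPred_eq] at hp ⊢
      refine ⟨⟨mem_image_of_mem _ hp.1.1, mem_image_of_mem _ hp.1.2⟩, ?_⟩
      have h1 : (x - y) ⬝ᵥ (z - y) = (z - y) ⬝ᵥ (z - y) := by
        have h2 : x - z = (x - y) - (z - y) := by abel
        have h3 := hp.2.2
        rw [← neg_sub z y, dotProduct_neg, neg_eq_zero, h2, sub_dotProduct, sub_eq_zero] at h3
        exact h3
      simp only [inv, dotProduct_smul, smul_eq_mul]
      rw [h1, inv_mul_cancel₀ hp.2.1]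
    · rintro ⟨x, z⟩ hp ⟨x', z'⟩ hp' heq
      simp only [coe_filter, mem_product, Set.mem_ofPred_eq, Prod.mk.injEq] at hp hp' heq
      exact Prod.ext (sub_left_injective heq.1) (hinj z z' hp.2.1 hp'.2.1 heq.2)
  have h1 : (#(E.image (· - y)) : ℝ) ≤ #E := by exact_mod_cast card_image_le
  have h2 : (#(E.image inv) : ℝ) ≤ #E := by exact_mod_cast card_image_le
  calc _ ≤ (#{p ∈ E.image (· - y) ×ˢ E.image inv | p.1 ⬝ᵥ p.2 = 1} : ℝ) := by exact_mod_cast hle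
    _ ≤ _ := card_dotProduct_eq_one_le _ _
    _ ≤ (#E : ℝ) * #E / Fintype.card F + √((Fintype.card F : ℝ) ^ (2 * k) * #E * #E) := by gcongr
    _ = _ := by
      have h3 : (Fintype.card F : ℝ) ^ (2 * k) * #E * #E = ((Fintype.card F : ℝ) ^ k * #E) ^ 2 := by
        ring
      rw [← sq, h3, Real.sqrt_sq (by positivity)]

/-- The triples `(x, y, z)` in `E` with a right angle at `z`; these index the additive quadruples
of the lift of `E` to the paraboloid. -/
theorem card_corners_le (hF : ringChar F ≠ 2) (he : e ≠ 1) {n k : ℕ} (hn : n = 2 * k + 1)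
    (E : Finset (Fin n → F)) :
    (#{p ∈ E ×ˢ E ×ˢ E | (p.2.1 - p.2.2) ⬝ᵥ (p.1 - p.2.2) = 0} : ℝ) ≤
      2 * ((#E : ℝ) ^ 3 / Fintype.card F + (Fintype.card F : ℝ) ^ k * (#E : ℝ) ^ 2) := by
  have hq : (0 : ℝ) < Fintype.card F := by exact_mod_cast Fintype.card_pos
  -- When `y - z` is isotropic, inversion is unavailable and every `x` is allowed; the cost is the
  -- number of isotropic pairs times `|E|`.
  have h1 : ∀ y ∈ E, #{p ∈ E ×ˢ E | (p.1 - p.2) ⬝ᵥ (y - p.2) = 0} ≤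
      #{p ∈ E ×ˢ E | (p.2 - y) ⬝ᵥ (p.2 - y) ≠ 0 ∧ (p.1 - p.2) ⬝ᵥ (y - p.2) = 0} +
        ∑ z ∈ E, if (y - z) ⬝ᵥ (y - z) = 0 then #E else 0 := fun y _ => by
    have h2 : ∑ z ∈ E, (if (y - z) ⬝ᵥ (y - z) = 0 then #E else 0) =
        #{p ∈ E ×ˢ E | (y - p.2) ⬝ᵥ (y - p.2) = 0} := by
      rw [card_filter, sum_product_right]
      refine sum_congr rfl fun z _ => ?_
      simp
    rw [h2]
    refine (card_le_card fun p hp => ?_).trans (card_union_le _ _)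
    simp only [mem_union, mem_filter] at hp ⊢
    by_cases h : (p.2 - y) ⬝ᵥ (p.2 - y) = 0
    · right
      rw [← neg_sub p.2 y, neg_dotProduct_neg]
      exact ⟨hp.1, h⟩
    · exact Or.inl ⟨hp.1, h, hp.2⟩
  have h3 : #{p ∈ E ×ˢ E ×ˢ E | (p.2.1 - p.2.2) ⬝ᵥ (p.1 - p.2.2) = 0} =
      ∑ y ∈ E, #{p ∈ E ×ˢ E | (p.1 - p.2) ⬝ᵥ (y - p.2) = 0} := by
    simp_rw [card_filter]
    rw [sum_product]
  have h4 : ∑ y ∈ E, ∑ z ∈ E, (if (y - z) ⬝ᵥ (y - z) = 0 then #E else 0) =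
      #{p ∈ E ×ˢ E | (p.1 - p.2) ⬝ᵥ (p.1 - p.2) = 0} * #E := by
    rw [card_filter, sum_product, sum_mul]
    simp_rw [sum_mul, ite_mul, one_mul, zero_mul]
  have h5 := h3.trans_le (sum_le_sum h1)
  rw [sum_add_distrib, h4] at h5
  calc _ ≤ (∑ y ∈ E,
        (#{p ∈ E ×ˢ E | (p.2 - y) ⬝ᵥ (p.2 - y) ≠ 0 ∧ (p.1 - p.2) ⬝ᵥ (y - p.2) = 0} : ℝ)) +
        #{p ∈ E ×ˢ E | (p.1 - p.2) ⬝ᵥ (p.1 - p.2) = 0} * #E := by exact_mod_cast h5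
    _ ≤ (∑ y ∈ E, ((#E : ℝ) ^ 2 / Fintype.card F + (Fintype.card F : ℝ) ^ k * #E)) +
        ((#E : ℝ) ^ 2 / Fintype.card F + (Fintype.card F : ℝ) ^ k * #E) * #E := by
        gcongr with y hy
        · exact card_right_angles_le hn E y
        · exact card_isotropic_pairs_le hF he hn E
    _ = _ := by
        rw [sum_const, nsmul_eq_mul]
        ring

end AdditiveEnergy

/-! ### Bounds for the restriction energy -/

section RestrictionEstimates

variable {F : Type*} [Field F]

/-- The point of the paraboloid above `x`. -/
def lift {n : ℕ} (x : Fin n → F) : Fin (n + 1) → F := Fin.snoc (α := fun _ => F) x (x ⬝ᵥ x)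

theorem dotProduct_lift {n : ℕ} (v : Fin (n + 1) → F) (x : Fin n → F) :
    v ⬝ᵥ lift x = Fin.init v ⬝ᵥ x + v (Fin.last n) * (x ⬝ᵥ x) := by
  simp [dotProduct, lift, Fin.sum_univ_castSucc, Fin.init]

theorem lift_injective {n : ℕ} : Function.Injective (lift : (Fin n → F) → _) := fun x y h => by
  have := congrArg Fin.init h
  simpa [lift] using this

/-- An additive quadruple on the paraboloid projects to a parallelogram; eliminating `w` from the
last coordinate leaves twice the inner product of the two sides at `z`. -/
theorem corner_of_lift_add_eq (hF : ringChar F ≠ 2) {n : ℕ} {x y z w : Fin n → F}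
    (h : lift x + lift y = lift z + lift w) : (y - z) ⬝ᵥ (x - z) = 0 ∧ w = x + y - z := by
  have h1 : x + y = z + w := by
    funext i
    have := congrFun h i.castSucc
    simpa [lift] using this
  have h2 : x ⬝ᵥ x + y ⬝ᵥ y = z ⬝ᵥ z + w ⬝ᵥ w := by
    have := congrFun h (Fin.last n)
    simpa [lift] using this
  have h3 : w = x + y - z := by rw [h1]; abel
  refine ⟨?_, h3⟩
  have h4 : 2 * ((y - z) ⬝ᵥ (x - z)) = 0 := by
    rw [h3] at h2
    simp only [sub_dotProduct, dotProduct_sub, add_dotProduct, dotProduct_add] at h2 ⊢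
    linear_combination -h2 - dotProduct_comm x y - dotProduct_comm y z - dotProduct_comm z x
  exact (mul_eq_zero.1 h4).resolve_left (Ring.two_ne_zero hF)

variable [Fintype F] {e : AddChar F ℂ}

/-- The square of the `L²` norm of the restriction of the Fourier transform of `g 1_G` to the
paraboloid, unnormalized. -/
noncomputable def restrictionEnergy (e : AddChar F ℂ) {n : ℕ} (G : Finset (Fin (n + 1) → F))
    (g : (Fin (n + 1) → F) → ℂ) : ℝ :=
  ∑ ξ : Fin n → F, ‖∑ x ∈ G, g x * e (x ⬝ᵥ lift ξ)‖ ^ 2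

/-- The Fourier transform of the paraboloid at `x - y`, unnormalized. -/
noncomputable def paraboloidKernel (e : AddChar F ℂ) {n : ℕ} (x y : Fin (n + 1) → F) : ℂ :=
  ∑ ξ : Fin n → F, e ((x - y) ⬝ᵥ lift ξ)

theorem restrictionEnergy_eq {n : ℕ} (G : Finset (Fin (n + 1) → F))
    (g : (Fin (n + 1) → F) → ℂ) :
    (restrictionEnergy e G g : ℂ) =
      ∑ x ∈ G, ∑ y ∈ G, g x * (starRingEnd ℂ) (g y) * paraboloidKernel e x y := by
  rw [restrictionEnergy, Complex.ofReal_sum]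
  simp_rw [normSq_sum_eq, paraboloidKernel, mul_sum]
  rw [sum_comm, sum_product]
  refine sum_congr rfl fun x _ => sum_congr rfl fun y _ => sum_congr rfl fun ξ _ => ?_
  rw [map_mul, ← AddChar.map_neg_eq_conj, sub_dotProduct, sub_eq_add_neg, AddChar.map_add_eq_mul]
  ring

theorem paraboloidKernel_of_last_ne (hF : ringChar F ≠ 2) {n : ℕ} {x y : Fin (n + 1) → F}
    (h : x (Fin.last n) ≠ y (Fin.last n)) :
    paraboloidKernel e x y =
      e (-((Fin.init x - Fin.init y) ⬝ᵥ (Fin.init x - Fin.init y)) /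
        (4 * (x (Fin.last n) - y (Fin.last n)))) *
        quadGaussSum e (x (Fin.last n) - y (Fin.last n)) ^ n := by
  have h1 : ∀ ξ : Fin n → F, (x - y) ⬝ᵥ lift ξ =
      (x (Fin.last n) - y (Fin.last n)) * (ξ ⬝ᵥ ξ) + ξ ⬝ᵥ (Fin.init x - Fin.init y) := fun ξ => by
    rw [dotProduct_lift, dotProduct_comm ξ (_ - _), add_comm]
    rfl
  simp_rw [paraboloidKernel, h1]
  rw [sum_char_quadratic hF (sub_ne_zero.2 h)]

theorem norm_quadGaussSum (hF : ringChar F ≠ 2) (he : e ≠ 1) {t : F} (ht : t ≠ 0) :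
    ‖quadGaussSum e t‖ = √(Fintype.card F) := by
  rw [← norm_quadGaussSum_sq hF he ht, Real.sqrt_sq (norm_nonneg _)]

variable [DecidableEq F]

/-- The fourth moment of the extension of a function supported on `A` is controlled by the number
of right angles in `A`. -/
theorem fourth_moment_le (hF : ringChar F ≠ 2) (he : e ≠ 1) {n : ℕ} (A : Finset (Fin n → F))
    (g : (Fin n → F) → ℂ) (hg : ∀ x, ‖g x‖ ≤ 1) :
    ∑ v, ‖∑ x ∈ A, g x * e (v ⬝ᵥ lift x)‖ ^ 4 ≤ (Fintype.card F : ℝ) ^ (n + 1) *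
      #{p ∈ A ×ˢ A ×ˢ A | (p.2.1 - p.2.2) ⬝ᵥ (p.1 - p.2.2) = 0} := by
  have h1 : ∀ v : Fin (n + 1) → F, ‖∑ x ∈ A, g x * e (v ⬝ᵥ lift x)‖ ^ 4 =
      ‖∑ p ∈ A ×ˢ A, g p.1 * g p.2 * e (v ⬝ᵥ (lift p.1 + lift p.2))‖ ^ 2 := fun v => by
    have h2 : ∑ p ∈ A ×ˢ A, g p.1 * g p.2 * e (v ⬝ᵥ (lift p.1 + lift p.2)) =
        (∑ x ∈ A, g x * e (v ⬝ᵥ lift x)) ^ 2 := by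
      rw [sq, sum_mul_sum, sum_product]
      refine sum_congr rfl fun x _ => sum_congr rfl fun y _ => ?_
      rw [dotProduct_add, AddChar.map_add_eq_mul]
      ring
    rw [h2, norm_pow, ← pow_mul]
  simp_rw [h1]
  refine (sum_norm_sq_charSum_le he (A ×ˢ A) (fun p => g p.1 * g p.2) (fun p _ => ?_)
    (fun p => lift p.1 + lift p.2)).trans ?_
  · rw [norm_mul]
    exact mul_le_one₀ (hg _) (norm_nonneg _) (hg _)
  · gcongr ?_ * (?_ : ℝ)
    rw [Nat.cast_le]
    -- The fourth vertex is determined by the other three.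
    refine card_le_card_of_injOn (fun p => (p.1.1, p.1.2, p.2.1)) ?_ ?_
    · rintro ⟨⟨x, y⟩, z, w⟩ hp
      simp only [coe_filter, mem_product, Set.mem_ofPred_eq] at hp ⊢
      exact ⟨⟨hp.1.1.1, hp.1.1.2, hp.1.2.1⟩, (corner_of_lift_add_eq hF hp.2).1⟩
    · rintro ⟨⟨x, y⟩, z, w⟩ hp ⟨⟨x', y'⟩, z', w'⟩ hp' heq
      simp only [coe_filter, mem_product, Set.mem_ofPred_eq, Prod.mk.injEq] at hp hp' heq ⊢
      obtain ⟨rfl, rfl, rfl⟩ := heq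
      have h3 := (corner_of_lift_add_eq hF hp.2).2
      have h4 := (corner_of_lift_add_eq hF hp'.2).2
      simp [h3, h4]

/-- Enlarge the paraboloid to the whole frequency space and apply Plancherel. The loss of a factor
`q` is harmless at very small heights `L`. -/
theorem restrictionEnergy_le_card (he : e ≠ 1) {n : ℕ} (G : Finset (Fin (n + 1) → F))
    (g : (Fin (n + 1) → F) → ℂ) (hg : ∀ x, ‖g x‖ ≤ 1) :
    restrictionEnergy e G g ≤ (Fintype.card F : ℝ) ^ (n + 1) * #G := by
  calc restrictionEnergy e G g ≤ ∑ v : Fin (n + 1) → F, ‖∑ x ∈ G, g x * e (v ⬝ᵥ x)‖ ^ 2 := by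
        rw [restrictionEnergy]
        simp_rw [dotProduct_comm _ (lift _)]
        rw [← sum_image (f := fun v => ‖∑ x ∈ G, g x * e (v ⬝ᵥ x)‖ ^ 2)
          (lift_injective.injOn)]
        exact sum_le_sum_of_subset_of_nonneg (subset_univ _) fun _ _ _ => by positivity
    _ ≤ _ := sum_norm_sq_charSum_le he G g (fun x _ => hg x) (fun x => x)
    _ ≤ _ := by
        gcongr
        exact_mod_cast card_diag_filter_le G (fun x => x) (fun _ _ _ _ h => h)

/-- At equal heights the quadratic phase cancels and a full character sum over `F^n` remains. -/
theorem paraboloidKernel_of_last_eq (he : e ≠ 1) {n : ℕ} {x y : Fin (n + 1) → F}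
    (h : x (Fin.last n) = y (Fin.last n)) :
    paraboloidKernel e x y = if x = y then (Fintype.card F : ℂ) ^ n else 0 := by
  have h1 : ∀ ξ : Fin n → F, (x - y) ⬝ᵥ lift ξ = ξ ⬝ᵥ (Fin.init x - Fin.init y) := fun ξ => by
    rw [dotProduct_lift, dotProduct_comm ξ (_ - _)]
    simp only [Pi.sub_apply, h, sub_self, zero_mul, add_zero]
    rfl
  simp_rw [paraboloidKernel, h1]
  rw [sum_char_dotProduct he]
  have h2 : Fin.init x - Fin.init y = 0 ↔ x = y := by
    rw [sub_eq_zero]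
    refine ⟨fun h3 => ?_, fun h3 => by rw [h3]⟩
    rw [← Fin.snoc_init_self x, ← Fin.snoc_init_self y, h3, h]
  simp only [h2]

/-- The Stein–Tomas estimate. -/
theorem restrictionEnergy_le_card_sq (hF : ringChar F ≠ 2) (he : e ≠ 1) {n : ℕ}
    (G : Finset (Fin (n + 1) → F)) (g : (Fin (n + 1) → F) → ℂ) (hg : ∀ x, ‖g x‖ ≤ 1) :
    restrictionEnergy e G g ≤
      (Fintype.card F : ℝ) ^ n * #G + √(Fintype.card F) ^ n * (#G : ℝ) ^ 2 := by
  have h0 : restrictionEnergy e G g = ‖(restrictionEnergy e G g : ℂ)‖ := by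
    rw [Complex.norm_real, Real.norm_of_nonneg]
    exact sum_nonneg fun _ _ => by positivity
  have h1 : ∀ x y : Fin (n + 1) → F, ‖paraboloidKernel e x y‖ ≤
      (if x = y then (Fintype.card F : ℝ) ^ n else 0) + √(Fintype.card F) ^ n := fun x y => by
    by_cases h : x (Fin.last n) = y (Fin.last n)
    · rw [paraboloidKernel_of_last_eq he h]
      split_ifs <;> simp
    · rw [paraboloidKernel_of_last_ne hF h, norm_mul, AddChar.norm_apply, one_mul, norm_pow,
        norm_quadGaussSum hF he (sub_ne_zero.2 h)]
      have : (0 : ℝ) ≤ if x = y then (Fintype.card F : ℝ) ^ n else 0 := by positivity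
      linarith
  rw [h0, restrictionEnergy_eq]
  calc _ ≤ ∑ x ∈ G, ∑ y ∈ G,
        ((if x = y then (Fintype.card F : ℝ) ^ n else 0) + √(Fintype.card F) ^ n) := by
        refine norm_sum_le_of_le _ fun x _ => norm_sum_le_of_le _ fun y _ => ?_
        rw [norm_mul, norm_mul, RCLike.norm_conj]
        exact (mul_le_of_le_one_left (norm_nonneg _)
          (mul_le_one₀ (hg x) (norm_nonneg _) (hg y))).trans (h1 x y)
    _ = _ := by
        simp only [sum_add_distrib, sum_ite_eq, sum_const, nsmul_eq_mul]
        rw [sum_congr rfl fun x hx => if_pos hx, sum_const, nsmul_eq_mul]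
        ring

/-- The horizontal slice of `G` at height `a`. -/
def slice {n : ℕ} (G : Finset (Fin (n + 1) → F)) (a : F) : Finset (Fin n → F) :=
  {X | Fin.snoc (α := fun _ => F) X a ∈ G}

theorem sum_slice {K M : Type*} [Fintype K] [DecidableEq K] [AddCommMonoid M] {n : ℕ}
    (G : Finset (Fin (n + 1) → K))
    (f : (Fin (n + 1) → K) → M) :
    ∑ x ∈ G, f x = ∑ a, ∑ X ∈ slice G a, f (Fin.snoc (α := fun _ => K) X a) := by
  simp_rw [slice, sum_filter]
  rw [← Fintype.sum_prod_type' (f := fun a X => if Fin.snoc (α := fun _ => K) X a ∈ G then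
    f (Fin.snoc (α := fun _ => K) X a) else 0), ← Fintype.sum_ite_mem]
  exact (Fintype.sum_equiv (Fin.snocEquiv fun _ : Fin (n + 1) => K) _ _ fun _ => rfl).symm

/-- The interaction of the slice of `G` at height `a` with the other slices. -/
theorem sum_norm_slice_kernel_pow_four_le (hF : ringChar F ≠ 2) (he : e ≠ 1) {n k : ℕ}
    (hn : n = 2 * k + 1) (G : Finset (Fin (n + 1) → F)) (g : (Fin (n + 1) → F) → ℂ)
    (hg : ∀ x, ‖g x‖ ≤ 1) (a : F) :
    (∑ y ∈ G with y (Fin.last n) ≠ a, ‖∑ X ∈ slice G a, g (Fin.snoc (α := fun _ => F) X a) *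
      paraboloidKernel e (Fin.snoc (α := fun _ => F) X a) y‖) ^ 4 ≤
      2 * (#G : ℝ) ^ 3 * (Fintype.card F : ℝ) ^ (3 * n) * ((#(slice G a) : ℝ) ^ 3 +
        (Fintype.card F : ℝ) ^ (k + 1) * (#(slice G a) : ℝ) ^ 2) := by
  have h2 : (2 : F) ≠ 0 := Ring.two_ne_zero hF
  have h4 : (4 : F) ≠ 0 := by
    have : (4 : F) = 2 * 2 := by norm_num
    rw [this]; exact mul_ne_zero h2 h2
  have hq : (0 : ℝ) < Fintype.card F := by exact_mod_cast Fintype.card_pos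
  set H := {y ∈ G | y (Fin.last n) ≠ a} with hH
  -- Pseudoconformal change of variables: in `-|X - Y|^2/(4(a - b))`, where `y = (Y, b)`, the terms
  -- depending on `X` are exactly `v y ⬝ lift X`. The last coordinate of `v y` recovers `b`, and
  -- then the others recover `Y`.
  let v : (Fin (n + 1) → F) → (Fin (n + 1) → F) := fun y =>
    Fin.snoc (α := fun _ => F) ((2 * (a - y (Fin.last n)))⁻¹ • Fin.init y)
      (-1 / (4 * (a - y (Fin.last n))))
  let S : (Fin (n + 1) → F) → ℂ := fun w =>
    ∑ X ∈ slice G a, g (Fin.snoc (α := fun _ => F) X a) * e (w ⬝ᵥ lift X)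
  have hv : Set.InjOn v H := by
    intro y hy y' hy' h
    simp only [hH, coe_filter, Set.mem_ofPred_eq] at hy hy'
    have hy0 := sub_ne_zero.2 hy.2.symm
    have hy0' := sub_ne_zero.2 hy'.2.symm
    have hl : y (Fin.last n) = y' (Fin.last n) := by
      have := congrFun h (Fin.last n)
      simp only [v, Fin.snoc_last] at this
      field_simp at this
      linear_combination -this
    have hi : Fin.init y = Fin.init y' := by
      have := congrArg Fin.init h
      simp only [v, Fin.init_snoc, ← hl] at this
      exact smul_right_injective _ (inv_ne_zero (mul_ne_zero h2 hy0)) this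
    rw [← Fin.snoc_init_self y, ← Fin.snoc_init_self y', hi, hl]
  have hS : ∀ y ∈ H, ‖∑ X ∈ slice G a, g (Fin.snoc (α := fun _ => F) X a) *
      paraboloidKernel e (Fin.snoc (α := fun _ => F) X a) y‖ ^ 4 =
        (Fintype.card F : ℝ) ^ (2 * n) * ‖S (v y)‖ ^ 4 := by
    intro y hy
    simp only [hH, mem_filter] at hy
    have hy0 := sub_ne_zero.2 hy.2.symm
    have h5 : ∑ X ∈ slice G a, g (Fin.snoc (α := fun _ => F) X a) *
        paraboloidKernel e (Fin.snoc (α := fun _ => F) X a) y =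
        quadGaussSum e (a - y (Fin.last n)) ^ n *
          e (-(Fin.init y ⬝ᵥ Fin.init y) / (4 * (a - y (Fin.last n)))) * S (v y) := by
      simp only [S]
      rw [mul_sum]
      refine sum_congr rfl fun X _ => ?_
      rw [paraboloidKernel_of_last_ne hF (by simpa using hy.2.symm)]
      simp only [Fin.snoc_last, Fin.init_snoc]
      have h6 : -((X - Fin.init y) ⬝ᵥ (X - Fin.init y)) / (4 * (a - y (Fin.last n))) =
          -(Fin.init y ⬝ᵥ Fin.init y) / (4 * (a - y (Fin.last n))) + v y ⬝ᵥ lift X := by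
        simp only [v]
        rw [dotProduct_lift, Fin.init_snoc, Fin.snoc_last, smul_dotProduct, smul_eq_mul,
          sub_dotProduct, dotProduct_sub, dotProduct_sub, dotProduct_comm X (Fin.init y)]
        have h7 : (4 : F) = 2 * 2 := by norm_num
        rw [h7]
        field_simp
        ring
      rw [h6, AddChar.map_add_eq_mul]
      ring
    rw [h5, norm_mul, norm_mul, AddChar.norm_apply, mul_one, norm_pow, mul_pow, ← pow_mul,
      mul_comm n 4, show 4 * n = 2 * (2 * n) by ring, pow_mul,
      norm_quadGaussSum_sq hF he hy0]
  -- Hölder's inequality with exponent 4, as Cauchy–Schwarz applied twice.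
  have hpow : ∀ c : (Fin (n + 1) → F) → ℝ, (∑ y ∈ H, c y) ^ 4 ≤ (#G : ℝ) ^ 3 * ∑ y ∈ H, c y ^ 4 := by
    intro c
    have h8 : (#H : ℝ) ≤ #G := by exact_mod_cast card_filter_le _ _
    calc (∑ y ∈ H, c y) ^ 4 = ((∑ y ∈ H, c y) ^ 2) ^ 2 := by ring
      _ ≤ (#H * ∑ y ∈ H, c y ^ 2) ^ 2 := by gcongr; exact sq_sum_le_card_mul_sum_sq
      _ = (#H : ℝ) ^ 2 * (∑ y ∈ H, c y ^ 2) ^ 2 := by ring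
      _ ≤ (#H : ℝ) ^ 2 * (#H * ∑ y ∈ H, (c y ^ 2) ^ 2) := by
          gcongr; exact sq_sum_le_card_mul_sum_sq
      _ = (#H : ℝ) ^ 3 * ∑ y ∈ H, c y ^ 4 := by simp_rw [← pow_mul]; ring
      _ ≤ _ := by gcongr
  calc _ ≤ (#G : ℝ) ^ 3 * ∑ y ∈ H, (Fintype.card F : ℝ) ^ (2 * n) * ‖S (v y)‖ ^ 4 := by
        rw [← sum_congr rfl hS]
        exact hpow _
    _ ≤ (#G : ℝ) ^ 3 * ((Fintype.card F : ℝ) ^ (2 * n) * ∑ w, ‖S w‖ ^ 4) := by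
        rw [← mul_sum, ← sum_image (f := fun w => ‖S w‖ ^ 4) hv]
        gcongr
        exact subset_univ _
    _ ≤ (#G : ℝ) ^ 3 * ((Fintype.card F : ℝ) ^ (2 * n) * ((Fintype.card F : ℝ) ^ (n + 1) *
          (2 * ((#(slice G a) : ℝ) ^ 3 / Fintype.card F +
            (Fintype.card F : ℝ) ^ k * (#(slice G a) : ℝ) ^ 2)))) := by
        gcongr
        refine (fourth_moment_le hF he _ (fun X => g (Fin.snoc (α := fun _ => F) X a))
          (fun X => hg _)).trans ?_
        gcongr
        exact card_corners_le hF he hn _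
    _ = _ := by
        field_simp
        ring

/-- The slicing estimate, combining Hölder's inequality with the bound for the number of right
angles in each slice. -/
theorem restrictionEnergy_le_slices (hF : ringChar F ≠ 2) (he : e ≠ 1) {n k : ℕ}
    (hn : n = 2 * k + 1) (G : Finset (Fin (n + 1) → F)) (g : (Fin (n + 1) → F) → ℂ)
    (hg : ∀ x, ‖g x‖ ≤ 1) {s M : ℝ} (hs : 0 ≤ s) (hsq : s ^ 4 = Fintype.card F) (hM : 0 ≤ M)
    (hMG : M ^ 4 = #G) :
    restrictionEnergy e G g ≤
      s ^ (4 * n) * M ^ 4 + 2 * s ^ (3 * n + 1) * M ^ 6 + 2 * s ^ (3 * n + k + 3) * M ^ 5 := by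
  let T : F → ℝ := fun a => ∑ y ∈ G with y (Fin.last n) ≠ a,
    ‖∑ X ∈ slice G a, g (Fin.snoc (α := fun _ => F) X a) *
      paraboloidKernel e (Fin.snoc (α := fun _ => F) X a) y‖
  -- Fourth roots `s`, `M`, `m a` of `q`, `|G|` and the slice sizes make all fractional powers
  -- integral. The sums of `m^2` and `m^3` over the `q` slices are controlled by Cauchy–Schwarz from
  -- the sum of `m^4`.
  let m : F → ℝ := fun a => √√(#(slice G a))
  have hm0 : ∀ a, 0 ≤ m a := fun a => Real.sqrt_nonneg _
  have hm2 : ∀ a, m a ^ 2 = √(#(slice G a)) := fun a => Real.sq_sqrt (Real.sqrt_nonneg _)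
  have hm4 : ∀ a, m a ^ 4 = #(slice G a) := fun a => by
    rw [show 4 = 2 * 2 by rfl, pow_mul, hm2, Real.sq_sqrt (Nat.cast_nonneg _)]
  have hsum4 : ∑ a, m a ^ 4 = M ^ 4 := by
    simp_rw [hm4]
    rw [hMG, card_eq_sum_ones, sum_slice, Nat.cast_sum]
    simp
  have hsum2 : ∑ a, m a ^ 2 ≤ s ^ 2 * M ^ 2 := by
    refine le_of_sq_le_sq ?_ (by positivity)
    calc (∑ a, m a ^ 2) ^ 2 ≤ #(univ : Finset F) * ∑ a, (m a ^ 2) ^ 2 := sq_sum_le_card_mul_sum_sq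
      _ = _ := by
        simp_rw [← pow_mul]
        rw [hsum4, card_univ, ← hsq]
        ring
  have hsum3 : ∑ a, m a ^ 3 ≤ s * M ^ 3 := by
    refine le_of_sq_le_sq ?_ (by positivity)
    calc (∑ a, m a ^ 3) ^ 2 = (∑ a, m a * m a ^ 2) ^ 2 := by simp_rw [pow_succ' _ 2]
      _ ≤ (∑ a, m a ^ 2) * ∑ a, (m a ^ 2) ^ 2 := sum_mul_sq_le_sq_mul_sq _ _ _
      _ ≤ (s ^ 2 * M ^ 2) * M ^ 4 := by
        simp_rw [← pow_mul]
        rw [hsum4]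
        gcongr
      _ = _ := by ring
  have hT : ∀ a, T a ≤ 2 * (s ^ (3 * n) * M ^ 3 * m a ^ 3 +
      s ^ (3 * n + k + 1) * M ^ 3 * m a ^ 2) := fun a => by
    have hm := hm0 a
    refine le_of_pow_le_pow_left₀ (n := 4) (by norm_num) (by positivity) ?_
    refine (sum_norm_slice_kernel_pow_four_le hF he hn G g hg a).trans ?_
    rw [← hm4 a, ← hsq, ← hMG]
    set A := s ^ (3 * n) * M ^ 3 * m a ^ 3 with hA
    set B := s ^ (3 * n + k + 1) * M ^ 3 * m a ^ 2 with hB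
    have hA0 : 0 ≤ A := by positivity
    have hB0 : 0 ≤ B := by positivity
    have h1 : 2 * (M ^ 4) ^ 3 * (s ^ 4) ^ (3 * n) * ((m a ^ 4) ^ 3 +
        (s ^ 4) ^ (k + 1) * (m a ^ 4) ^ 2) = 2 * (A ^ 4 + B ^ 4) := by
      rw [hA, hB]
      ring
    rw [h1, mul_pow]
    have h2 : A ^ 4 + B ^ 4 ≤ (A + B) ^ 4 := pow_add_pow_le hA0 hB0 (by norm_num)
    have h3 : 0 ≤ (A + B) ^ 4 := by positivity
    linarith
  have h0 : restrictionEnergy e G g = ‖(restrictionEnergy e G g : ℂ)‖ := by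
    rw [Complex.norm_real, Real.norm_of_nonneg]
    exact sum_nonneg fun _ _ => by positivity
  -- Pairs at equal height collapse to the diagonal; the others are grouped by the height `a` of the
  -- first point.
  have hsplit : (restrictionEnergy e G g : ℂ) =
      ∑ y ∈ G, ∑ x ∈ G with x (Fin.last n) = y (Fin.last n),
        g x * (starRingEnd ℂ) (g y) * paraboloidKernel e x y +
      ∑ a, ∑ y ∈ G with y (Fin.last n) ≠ a, (starRingEnd ℂ) (g y) *
        ∑ X ∈ slice G a, g (Fin.snoc (α := fun _ => F) X a) *
          paraboloidKernel e (Fin.snoc (α := fun _ => F) X a) y := by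
    have h1 : ∑ a, ∑ y ∈ G with y (Fin.last n) ≠ a, (starRingEnd ℂ) (g y) *
        ∑ X ∈ slice G a, g (Fin.snoc (α := fun _ => F) X a) *
          paraboloidKernel e (Fin.snoc (α := fun _ => F) X a) y =
        ∑ y ∈ G, ∑ x ∈ G with ¬ x (Fin.last n) = y (Fin.last n),
          g x * (starRingEnd ℂ) (g y) * paraboloidKernel e x y := by
      simp_rw [sum_filter]
      rw [sum_comm]
      refine sum_congr rfl fun y _ => ?_
      rw [sum_slice G]
      refine sum_congr rfl fun a _ => ?_
      simp only [Fin.snoc_last, ne_comm (b := a), ne_eq]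
      split_ifs with h
      · simp
      · rw [mul_sum]
        exact sum_congr rfl fun X _ => by ring
    rw [h1, ← sum_add_distrib, restrictionEnergy_eq, sum_comm]
    exact sum_congr rfl fun y _ => (sum_filter_add_sum_filter_not _ _ _).symm
  rw [h0, hsplit]
  refine (norm_add_le _ _).trans ?_
  have hdiag : ‖∑ y ∈ G, ∑ x ∈ G with x (Fin.last n) = y (Fin.last n),
      g x * (starRingEnd ℂ) (g y) * paraboloidKernel e x y‖ ≤ s ^ (4 * n) * M ^ 4 := by
    calc _ ≤ ∑ y ∈ G, s ^ (4 * n) := by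
          refine norm_sum_le_of_le _ fun y hy => ?_
          have h1 : ∑ x ∈ G with x (Fin.last n) = y (Fin.last n),
              g x * (starRingEnd ℂ) (g y) * paraboloidKernel e x y =
              g y * (starRingEnd ℂ) (g y) * (Fintype.card F : ℂ) ^ n := by
            rw [sum_eq_single_of_mem y (by simp [hy])]
            · rw [paraboloidKernel_of_last_eq he rfl, if_pos rfl]
            · intro x hx hxy
              rw [paraboloidKernel_of_last_eq he (mem_filter.1 hx).2, if_neg hxy, mul_zero]
          rw [h1, norm_mul, norm_mul, RCLike.norm_conj, norm_pow, Complex.norm_natCast, ← hsq,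
            ← pow_mul]
          exact mul_le_of_le_one_left (by positivity) (mul_le_one₀ (hg y) (norm_nonneg _) (hg y))
      _ = _ := by rw [sum_const, nsmul_eq_mul, hMG]; ring
  have hoff : ‖∑ a, ∑ y ∈ G with y (Fin.last n) ≠ a, (starRingEnd ℂ) (g y) *
        ∑ X ∈ slice G a, g (Fin.snoc (α := fun _ => F) X a) *
          paraboloidKernel e (Fin.snoc (α := fun _ => F) X a) y‖ ≤ ∑ a, T a := by
    refine norm_sum_le_of_le _ fun a _ => norm_sum_le_of_le _ fun y _ => ?_
    rw [norm_mul, RCLike.norm_conj]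
    exact mul_le_of_le_one_left (norm_nonneg _) (hg y)
  have hTsum : ∑ a, T a ≤ 2 * (s ^ (3 * n) * M ^ 3 * (s * M ^ 3) +
      s ^ (3 * n + k + 1) * M ^ 3 * (s ^ 2 * M ^ 2)) := by
    refine (sum_le_sum fun a _ => hT a).trans ?_
    rw [← mul_sum, sum_add_distrib, ← mul_sum, ← mul_sum]
    gcongr
  refine (add_le_add hdiag (hoff.trans hTsum)).trans (le_of_eq ?_)
  ring

end RestrictionEstimates

/-! ### Duality and level sets -/

section Duality

variable {F : Type*} [Field F] [Fintype F] {e : AddChar F ℂ}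

theorem lift_mem_paraboloid {n : ℕ} (x : Fin n → F) : lift x ∈ paraboloid F n := by
  classical
  exact mem_image_of_mem _ (mem_univ x)

theorem card_paraboloid (n : ℕ) : #(paraboloid F n) = Fintype.card F ^ n := by
  classical
  refine (card_image_of_injective univ (lift_injective (F := F) (n := n))).trans ?_
  rw [card_univ, Fintype.card_fun, Fintype.card_fin]

theorem sum_paraboloid {M : Type*} [AddCommMonoid M] {n : ℕ} (φ : paraboloid F n → M) :
    ∑ ξ, φ ξ = ∑ x : Fin n → F, φ ⟨lift x, lift_mem_paraboloid x⟩ := by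
  classical
  refine (Function.Bijective.sum_comp (e := fun x : Fin n → F =>
    (⟨lift x, lift_mem_paraboloid x⟩ : paraboloid F n)) ⟨fun x y h => ?_, ?_⟩ φ).symm
  · exact lift_injective (Subtype.mk.inj h)
  · rintro ⟨ξ, hξ⟩
    obtain ⟨x, -, rfl⟩ := mem_image.1 hξ
    exact ⟨x, rfl⟩

theorem surfaceNorm_nonneg {n : ℕ} (p : ℝ) (f : paraboloid F n → ℂ) : 0 ≤ surfaceNorm p f := by
  rw [surfaceNorm]
  positivity

theorem card_pow_mul_surfaceNorm_two_sq {n : ℕ} (f : paraboloid F n → ℂ) :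
    (Fintype.card F : ℝ) ^ n * surfaceNorm 2 f ^ 2 =
      ∑ x : Fin n → F, ‖f ⟨lift x, lift_mem_paraboloid x⟩‖ ^ 2 := by
  have hq : (0 : ℝ) < Fintype.card F := by exact_mod_cast Fintype.card_pos
  rw [surfaceNorm, sum_paraboloid, card_paraboloid, ← Real.sqrt_eq_rpow, Real.sq_sqrt (by positivity)]
  simp_rw [Real.rpow_two]
  push_cast
  rw [mul_inv_cancel_left₀ (by positivity)]

/-- Where the extension of `f` is large, a dual function has large restriction energy. -/
theorem exists_restrictionEnergy_ge {n : ℕ} (f : paraboloid F n → ℂ)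
    (G : Finset (Fin (n + 1) → F)) {L : ℝ} (hL : 0 ≤ L) (hG : ∀ x ∈ G, L ≤ ‖extensionOp e f x‖) :
    ∃ g : (Fin (n + 1) → F) → ℂ, (∀ x, ‖g x‖ ≤ 1) ∧
      (Fintype.card F : ℝ) ^ n * (L * #G) ^ 2 ≤ surfaceNorm 2 f ^ 2 * restrictionEnergy e G g := by
  have hq : (0 : ℝ) < Fintype.card F := by exact_mod_cast Fintype.card_pos
  -- The conjugate phase of the extension; division by zero makes it 0 where the extension vanishes.
  let g : (Fin (n + 1) → F) → ℂ := fun x =>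
    (starRingEnd ℂ) (extensionOp e f x) / ‖extensionOp e f x‖
  refine ⟨g, fun x => ?_, ?_⟩
  · simp only [g, norm_div, RCLike.norm_conj, Complex.norm_real, norm_norm]
    exact div_self_le_one _
  have hgE : ∀ x, g x * extensionOp e f x = ‖extensionOp e f x‖ := fun x => by
    simp only [g]
    rw [div_mul_eq_mul_div, Complex.conj_mul', sq]
    by_cases h : (‖extensionOp e f x‖ : ℂ) = 0
    · simp [h]
    · rw [mul_div_cancel_right₀ _ h]
  have hsum : (((Fintype.card F : ℝ) ^ n * ∑ x ∈ G, ‖extensionOp e f x‖ : ℝ) : ℂ) =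
      ∑ ξ : Fin n → F, f ⟨lift ξ, lift_mem_paraboloid ξ⟩ * ∑ x ∈ G, g x * e (x ⬝ᵥ lift ξ) := by
    have hqc : ((Fintype.card F : ℂ) ^ n) ≠ 0 := by
      exact_mod_cast (pow_pos hq n).ne'
    have h1 : ∀ x, (Fintype.card F : ℂ) ^ n * (‖extensionOp e f x‖ : ℂ) =
        ∑ ξ : Fin n → F, f ⟨lift ξ, lift_mem_paraboloid ξ⟩ * (g x * e (x ⬝ᵥ lift ξ)) := fun x => by
      rw [← hgE, extensionOp, sum_paraboloid, card_paraboloid]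
      push_cast
      rw [mul_left_comm, mul_inv_cancel_left₀ hqc, mul_sum]
      exact sum_congr rfl fun ξ _ => by ring
    push_cast
    rw [mul_sum, sum_congr rfl fun x _ => h1 x, sum_comm]
    simp_rw [mul_sum]
  have hle : (Fintype.card F : ℝ) ^ n * (L * #G) ≤
      ∑ ξ : Fin n → F, ‖f ⟨lift ξ, lift_mem_paraboloid ξ⟩‖ * ‖∑ x ∈ G, g x * e (x ⬝ᵥ lift ξ)‖ := by
    calc (Fintype.card F : ℝ) ^ n * (L * #G) ≤
          (Fintype.card F : ℝ) ^ n * ∑ x ∈ G, ‖extensionOp e f x‖ := by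
          gcongr
          rw [mul_comm, ← nsmul_eq_mul]
          exact card_nsmul_le_sum _ _ _ hG
      _ = ‖(((Fintype.card F : ℝ) ^ n * ∑ x ∈ G, ‖extensionOp e f x‖ : ℝ) : ℂ)‖ := by
          rw [Complex.norm_real, Real.norm_of_nonneg (by positivity)]
      _ ≤ _ := by
          rw [hsum]
          exact norm_sum_le_of_le _ fun ξ _ => (norm_mul _ _).le
  have hsq := (pow_le_pow_left₀ (by positivity) hle 2).trans (sum_mul_sq_le_sq_mul_sq _ _ _)
  rw [← card_pow_mul_surfaceNorm_two_sq] at hsq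
  rw [← mul_le_mul_iff_right₀ (pow_pos hq n)]
  calc _ = ((Fintype.card F : ℝ) ^ n * (L * #G)) ^ 2 := by ring
    _ ≤ _ := hsq
    _ = _ := by rw [restrictionEnergy]; ring

/-- Duality applied to a single point. It fixes the top of the dyadic scale, so only heights at most
`surfaceNorm 2 f` occur. -/
theorem norm_extensionOp_le {n : ℕ} (f : paraboloid F n → ℂ) (x : Fin (n + 1) → F) :
    ‖extensionOp e f x‖ ≤ surfaceNorm 2 f := by
  have hq : (0 : ℝ) < Fintype.card F := by exact_mod_cast Fintype.card_pos
  obtain ⟨g, hg, h⟩ := exists_restrictionEnergy_ge (e := e) f {x}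
    (norm_nonneg (extensionOp e f x)) (by simp)
  have hR : restrictionEnergy e {x} g ≤ (Fintype.card F : ℝ) ^ n := by
    calc restrictionEnergy e {x} g ≤ ∑ _ξ : Fin n → F, (1 : ℝ) := by
          refine sum_le_sum fun ξ _ => ?_
          rw [sum_singleton, norm_mul, AddChar.norm_apply, mul_one]
          exact pow_le_one₀ (norm_nonneg _) (hg x)
      _ = _ := by simp
  refine le_of_sq_le_sq ?_ (surfaceNorm_nonneg 2 f)
  rw [← mul_le_mul_iff_right₀ (pow_pos hq n)]
  calc _ = (Fintype.card F : ℝ) ^ n * (‖extensionOp e f x‖ * #{x}) ^ 2 := by simp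
    _ ≤ _ := h
    _ ≤ surfaceNorm 2 f ^ 2 * (Fintype.card F : ℝ) ^ n := by gcongr
    _ = _ := mul_comm _ _

/-- Dyadic decomposition: bounds for the level sets of the extension yield an extension
estimate. -/
theorem extensionConst_le_of_level_bound {n : ℕ} {r K : ℝ} (hr : 0 < r) (b : ℕ → ℝ)
    (hb : ∀ I, ∑ i ∈ range I, b i ≤ K)
    (h : ∀ (i : ℕ) (G : Finset (Fin (n + 1) → F)) (g : (Fin (n + 1) → F) → ℂ), G.Nonempty →
      (∀ x, ‖g x‖ ≤ 1) →
      (Fintype.card F : ℝ) ^ n * ((1 / 2) ^ (i + 1) * #G) ^ 2 ≤ restrictionEnergy e G g →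
      #G * ((1 / 2 : ℝ) ^ (i + 1)) ^ r ≤ b i)
    (hb0 : ∀ i, 0 ≤ b i) :
    extensionConst e n 2 r ≤ ((2 ^ r * K) ^ (1 / r)).toNNReal := by
  classical
  refine iInf₂_le _ fun f => ?_
  have hK : 0 ≤ K := (hb 0).trans' (by simp)
  rw [Real.coe_toNNReal _ (by positivity)]
  set A := surfaceNorm 2 f with hA
  rcases (surfaceNorm_nonneg 2 f).eq_or_lt with h0 | hA0
  · have h1 : ∀ x, ‖extensionOp e f x‖ = 0 := fun x =>
      le_antisymm ((norm_extensionOp_le f x).trans h0.ge) (norm_nonneg _)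
    rw [countingNorm]
    simp_rw [h1]
    rw [Real.zero_rpow hr.ne', sum_const_zero, Real.zero_rpow (by positivity)]
    exact mul_nonneg (by positivity) (surfaceNorm_nonneg 2 f)
  rw [← hA] at hA0
  let lev : ℕ → Finset (Fin (n + 1) → F) := fun i =>
    {x | (1 / 2) ^ (i + 1) * A < ‖extensionOp e f x‖ ∧ ‖extensionOp e f x‖ ≤ (1 / 2) ^ i * A}
  have hlev : ∀ i, ∑ x ∈ lev i, ‖extensionOp e f x‖ ^ r ≤ 2 ^ r * A ^ r * b i := by
    intro i
    rcases (lev i).eq_empty_or_nonempty with hne | hne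
    · rw [hne, sum_empty]
      have := hb0 i
      positivity
    obtain ⟨g, hg, hR⟩ := exists_restrictionEnergy_ge (e := e) f (lev i)
      (L := (1 / 2) ^ (i + 1) * A) (by positivity) fun x hx => ((mem_filter.1 hx).2.1).le
    have hR2 : (Fintype.card F : ℝ) ^ n * ((1 / 2) ^ (i + 1) * #(lev i)) ^ 2 ≤
        restrictionEnergy e (lev i) g := by
      rw [← hA] at hR
      rw [← mul_le_mul_iff_right₀ (pow_pos hA0 2)]
      refine le_trans (le_of_eq ?_) hR
      ring
    have hi := h i (lev i) g hne hg hR2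
    calc ∑ x ∈ lev i, ‖extensionOp e f x‖ ^ r ≤
          #(lev i) • (2 * A * (1 / 2) ^ (i + 1)) ^ r := by
          refine sum_le_card_nsmul _ _ _ fun x hx => ?_
          refine Real.rpow_le_rpow (norm_nonneg _) ((mem_filter.1 hx).2.2.trans (le_of_eq ?_)) hr.le
          ring
      _ = 2 ^ r * A ^ r * (#(lev i) * ((1 / 2 : ℝ) ^ (i + 1)) ^ r) := by
          rw [nsmul_eq_mul, Real.mul_rpow (by positivity) (by positivity),
            Real.mul_rpow (by positivity) (by positivity)]
          ring
      _ ≤ _ := by gcongr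
  have hidx : ∀ x, ∃ i, ‖extensionOp e f x‖ ≠ 0 → x ∈ lev i := by
    intro x
    by_cases hx : ‖extensionOp e f x‖ = 0
    · exact ⟨0, fun h => absurd hx h⟩
    · have hx0 := lt_of_le_of_ne (norm_nonneg _) (Ne.symm hx)
      obtain ⟨i, hi1, hi2⟩ := exists_nat_pow_near_of_lt_one (div_pos hx0 hA0)
        ((div_le_one hA0).2 (norm_extensionOp_le f x)) (y := (1 / 2 : ℝ)) (by norm_num)
        (by norm_num)
      refine ⟨i, fun _ => mem_filter.2 ⟨mem_univ _, (lt_div_iff₀ hA0).1 hi1,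
        (div_le_iff₀ hA0).1 hi2⟩⟩
  choose idx hidx using hidx
  -- The space is finite, so finitely many levels suffice for a given `f`; the bound `K` does not
  -- depend on their number.
  let I := univ.sup idx + 1
  have htotal : ∑ x, ‖extensionOp e f x‖ ^ r ≤ 2 ^ r * K * A ^ r := by
    calc ∑ x, ‖extensionOp e f x‖ ^ r ≤
          ∑ x, ∑ i ∈ range I, if x ∈ lev i then ‖extensionOp e f x‖ ^ r else 0 := by
          refine sum_le_sum fun x _ => ?_
          have hnn : ∀ i ∈ range I, 0 ≤ if x ∈ lev i then ‖extensionOp e f x‖ ^ r else 0 :=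
            fun i _ => by positivity
          by_cases hx : ‖extensionOp e f x‖ = 0
          · rw [hx, Real.zero_rpow hr.ne']
            simp
          · refine le_trans (le_of_eq ?_) (single_le_sum hnn
              (mem_range.2 (Nat.lt_succ_of_le (le_sup (mem_univ x)))))
            rw [if_pos (hidx x hx)]
      _ = ∑ i ∈ range I, ∑ x ∈ lev i, ‖extensionOp e f x‖ ^ r := by
          rw [sum_comm]
          simp_rw [sum_ite_mem, univ_inter]
      _ ≤ ∑ i ∈ range I, 2 ^ r * A ^ r * b i := sum_le_sum fun i _ => hlev i
      _ ≤ 2 ^ r * A ^ r * K := by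
          rw [← mul_sum]
          gcongr
          exact hb I
      _ = _ := by ring
  calc countingNorm r (extensionOp e f) ≤ (2 ^ r * K * A ^ r) ^ (1 / r) :=
        Real.rpow_le_rpow (by positivity) htotal (by positivity)
    _ = _ := by
        rw [Real.mul_rpow (by positivity) (by positivity), ← Real.rpow_mul hA0.le,
          mul_one_div_cancel hr.ne', Real.rpow_one]

/-- Level sets of the extension operator from `L²`, in even dimension. -/
theorem level_trichotomy (hF : ringChar F ≠ 2) (he : e ≠ 1) {n k : ℕ} (hn : n = 2 * k + 1)
    {G : Finset (Fin (n + 1) → F)} (hG : G.Nonempty) {g : (Fin (n + 1) → F) → ℂ}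
    (hg : ∀ x, ‖g x‖ ≤ 1) {L : ℝ}
    (h : (Fintype.card F : ℝ) ^ n * (L * #G) ^ 2 ≤ restrictionEnergy e G g) :
    L ^ 2 * #G ≤ 3 ∨ (Fintype.card F : ℝ) ^ k * L ^ 4 * #G ≤ 36 ∨
      (Fintype.card F : ℝ) ^ k * L ^ 8 * (#G : ℝ) ^ 3 ≤ 1296 * (Fintype.card F : ℝ) ^ 2 := by
  classical
  have hq : (0 : ℝ) < Fintype.card F := by exact_mod_cast Fintype.card_pos
  have hN : (0 : ℝ) < #G := by exact_mod_cast hG.card_pos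
  obtain ⟨s, hs, hsq⟩ : ∃ s : ℝ, 0 < s ∧ s ^ 4 = Fintype.card F :=
    ⟨√√(Fintype.card F), by positivity, by
      rw [show 4 = 2 * 2 by rfl, pow_mul, Real.sq_sqrt (by positivity), Real.sq_sqrt hq.le]⟩
  obtain ⟨M, hM, hMG⟩ : ∃ M : ℝ, 0 < M ∧ M ^ 4 = #G :=
    ⟨√√(#G), by positivity, by
      rw [show 4 = 2 * 2 by rfl, pow_mul, Real.sq_sqrt (by positivity), Real.sq_sqrt hN.le]⟩
  have h1 := h.trans (restrictionEnergy_le_slices hF he hn G g hg hs.le hsq hM.le hMG)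
  rw [← hsq, ← hMG] at h1 ⊢
  subst hn
  -- If all three alternatives failed, each term of the slicing bound would be less than a third of
  -- the left side. The coefficients 1, 2, 2 give the thresholds 3, `6^2` and `6^4`.
  by_contra! hcon
  obtain ⟨h2, h3, h4⟩ := hcon
  have e3 : 6 < s ^ (2 * k) * L ^ 2 * M ^ 2 := by
    refine lt_of_pow_lt_pow_left₀ 2 (by positivity) ?_
    calc (6 : ℝ) ^ 2 = 36 := by norm_num
      _ < _ := h3
      _ = _ := by ring
  have e4 : 6 * s ^ 2 < s ^ k * L ^ 2 * M ^ 3 := by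
    refine lt_of_pow_lt_pow_left₀ 4 (by positivity) ?_
    calc (6 * s ^ 2) ^ 4 = 1296 * (s ^ 4) ^ 2 := by ring
      _ < _ := h4
      _ = _ := by ring
  have t2 : 3 * (s ^ (8 * k + 4) * M ^ 4) < L ^ 2 * M ^ 4 * (s ^ (8 * k + 4) * M ^ 4) :=
    mul_lt_mul_of_pos_right h2 (by positivity)
  have t3 : 6 * (s ^ (6 * k + 4) * M ^ 6) < s ^ (2 * k) * L ^ 2 * M ^ 2 * (s ^ (6 * k + 4) * M ^ 6) :=
    mul_lt_mul_of_pos_right e3 (by positivity)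
  have t4 : 6 * s ^ 2 * (s ^ (7 * k + 4) * M ^ 5) <
      s ^ k * L ^ 2 * M ^ 3 * (s ^ (7 * k + 4) * M ^ 5) :=
    mul_lt_mul_of_pos_right e4 (by positivity)
  ring_nf at h1 t2 t3 t4
  linarith

theorem level_mul_card_le (he : e ≠ 1) {n : ℕ}
    {G : Finset (Fin (n + 1) → F)} (hG : G.Nonempty) {g : (Fin (n + 1) → F) → ℂ}
    (hg : ∀ x, ‖g x‖ ≤ 1) {L : ℝ}
    (h : (Fintype.card F : ℝ) ^ n * (L * #G) ^ 2 ≤ restrictionEnergy e G g) :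
    L ^ 2 * #G ≤ Fintype.card F := by
  classical
  have hq : (0 : ℝ) < Fintype.card F := by exact_mod_cast Fintype.card_pos
  have hN : (0 : ℝ) < #G := by exact_mod_cast hG.card_pos
  have h1 := h.trans (restrictionEnergy_le_card he G g hg)
  refine le_of_mul_le_mul_left (a := (Fintype.card F : ℝ) ^ n * #G) ?_ (by positivity)
  calc _ = _ := by ring
    _ ≤ _ := h1
    _ = _ := by ring

/-- One of the two Stein–Tomas terms dominates. The second alternative caps the height at a multiple
of `q^(-n/4)`, whatever the size of `G`. -/
theorem level_dichotomy (hF : ringChar F ≠ 2) (he : e ≠ 1) {n : ℕ}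
    {G : Finset (Fin (n + 1) → F)} (hG : G.Nonempty) {g : (Fin (n + 1) → F) → ℂ}
    (hg : ∀ x, ‖g x‖ ≤ 1) {L : ℝ}
    (h : (Fintype.card F : ℝ) ^ n * (L * #G) ^ 2 ≤ restrictionEnergy e G g) :
    L ^ 2 * #G ≤ 2 ∨ (Fintype.card F : ℝ) ^ n * L ^ 4 ≤ 4 := by
  classical
  have hq : (0 : ℝ) < Fintype.card F := by exact_mod_cast Fintype.card_pos
  have hN : (0 : ℝ) < #G := by exact_mod_cast hG.card_pos
  have h1 := h.trans (restrictionEnergy_le_card_sq hF he G g hg)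
  set s := √(Fintype.card F : ℝ) with hs
  have hs0 : 0 < s := by positivity
  have hsq : (Fintype.card F : ℝ) = s ^ 2 := (Real.sq_sqrt hq.le).symm
  rw [hsq] at h1 ⊢
  by_contra! hcon
  obtain ⟨h2, h3⟩ := hcon
  have e3 : 2 < s ^ n * L ^ 2 := by
    refine lt_of_pow_lt_pow_left₀ 2 (by positivity) ?_
    calc (2 : ℝ) ^ 2 = 4 := by norm_num
      _ < _ := h3
      _ = _ := by ring
  have t2 : 2 * (s ^ (2 * n) * #G) < L ^ 2 * #G * (s ^ (2 * n) * #G) :=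
    mul_lt_mul_of_pos_right h2 (mul_pos (pow_pos hs0 _) hN)
  have t3 : 2 * (s ^ n * (#G : ℝ) ^ 2) < s ^ n * L ^ 2 * (s ^ n * (#G : ℝ) ^ 2) :=
    mul_lt_mul_of_pos_right e3 (mul_pos (pow_pos hs0 _) (pow_pos hN 2))
  ring_nf at h1 t2 t3
  linarith

end Duality

/-! ### Summation over dyadic heights -/

section DyadicSums

theorem sum_pow_natAbs_le {ρ : ℝ} (h0 : 0 ≤ ρ) (h1 : ρ < 1) (m : ℤ) (I : ℕ) :
    ∑ i ∈ range I, ρ ^ (m - i).natAbs ≤ 2 * (1 - ρ)⁻¹ := by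
  have key : ∀ S : Finset ℕ, Set.InjOn (fun i : ℕ => (m - i).natAbs) S →
      ∑ i ∈ S, ρ ^ (m - i).natAbs ≤ (1 - ρ)⁻¹ := fun S hS => by
    rw [← tsum_geometric_of_lt_one h0 h1, ← sum_image (f := fun j => ρ ^ j) hS]
    exact (summable_geometric_of_lt_one h0 h1).sum_le_tsum _ fun _ _ => by positivity
  -- On each side of `m` the distance to `m` is injective, so each half is at most one geometric
  -- series.
  rw [← sum_filter_add_sum_filter_not _ fun i : ℕ => (i : ℤ) ≤ m, two_mul]
  refine add_le_add (key _ fun i hi j hj hij => ?_) (key _ fun i hi j hj hij => ?_) <;>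
  · simp only [coe_filter, Set.mem_ofPred_eq] at hi hj hij
    omega

/-- A dyadic sum of a quantity that decays geometrically on both sides of its peak. -/
theorem exists_dyadic_sum_le {a b : ℝ} (ha : 0 < a) (hb : 0 < b) :
    ∃ C : ℝ, ∀ t : ℝ, 0 < t → ∀ I : ℕ, ∑ i ∈ range I,
      min ((t * (1 / 2) ^ (i + 1)) ^ a) ((t * (1 / 2) ^ (i + 1)) ^ (-b)) ≤ C := by
  set c := min a b with hc
  have hc0 : 0 < c := lt_min ha hb
  have hρ0 : (0 : ℝ) ≤ 2 ^ (-c) := by positivity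
  have hρ1 : (2 : ℝ) ^ (-c) < 1 := Real.rpow_lt_one_of_one_lt_of_neg (by norm_num) (by linarith)
  refine ⟨2 ^ c * (2 * (1 - 2 ^ (-c))⁻¹), fun t ht I => ?_⟩
  set τ := Real.logb 2 t with hτ
  have ht2 : t = 2 ^ τ := (Real.rpow_logb (by norm_num) (by norm_num) ht).symm
  set m := ⌊τ⌋ - 1 with hm
  have hterm : ∀ i : ℕ, min ((t * (1 / 2) ^ (i + 1)) ^ a) ((t * (1 / 2) ^ (i + 1)) ^ (-b)) ≤
      2 ^ c * ((2 : ℝ) ^ (-c)) ^ (m - i).natAbs := by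
    intro i
    have hu : t * (1 / 2) ^ (i + 1) = (2 : ℝ) ^ (τ - i - 1) := by
      rw [ht2, one_div, inv_pow, ← div_eq_mul_inv, ← Real.rpow_natCast 2 (i + 1),
        ← Real.rpow_sub (by norm_num)]
      congr 1
      push_cast
      ring
    set w := τ - i - 1 with hw
    have hmw : (((m - i).natAbs : ℕ) : ℝ) ≤ |w| + 1 := by
      rw [Nat.cast_natAbs, Int.cast_abs]
      have h1 := Int.floor_le τ
      have h2 := Int.lt_floor_add_one τ
      push_cast [hm]
      have h3 : |(⌊τ⌋ : ℝ) - 1 - i| ≤ |w| + |(⌊τ⌋ : ℝ) - τ| := by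
        refine le_trans (le_of_eq ?_) (abs_add_le _ _)
        congr 1
        rw [hw]
        ring
      have h4 : |(⌊τ⌋ : ℝ) - τ| ≤ 1 := by
        rw [abs_le]
        constructor <;> linarith
      linarith
    -- The factor `2 ^ c` pays for replacing `τ` by its integer part.
    have hR : (2 : ℝ) ^ (-(c * |w|)) ≤ 2 ^ c * ((2 : ℝ) ^ (-c)) ^ (m - i).natAbs := by
      rw [← Real.rpow_natCast, ← Real.rpow_mul (by norm_num), ← Real.rpow_add (by norm_num)]
      refine Real.rpow_le_rpow_of_exponent_le (by norm_num) ?_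
      nlinarith
    refine le_trans ?_ hR
    rw [hu, ← Real.rpow_mul (by norm_num), ← Real.rpow_mul (by norm_num)]
    rcases le_total 0 w with h | h
    · refine (min_le_right _ _).trans (Real.rpow_le_rpow_of_exponent_le (by norm_num) ?_)
      rw [abs_of_nonneg h]
      nlinarith [min_le_right a b]
    · refine (min_le_left _ _).trans (Real.rpow_le_rpow_of_exponent_le (by norm_num) ?_)
      rw [abs_of_nonpos h]
      nlinarith [min_le_left a b]
  refine (sum_le_sum fun i _ => hterm i).trans ?_
  rw [← mul_sum]
  gcongr
  exact sum_pow_natAbs_le hρ0 hρ1 m I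

theorem exists_sum_rpow_le {a : ℝ} (ha : 0 < a) :
    ∃ C : ℝ, ∀ I : ℕ, ∑ i ∈ range I, ((1 / 2 : ℝ) ^ (i + 1)) ^ a ≤ C := by
  obtain ⟨C, hC⟩ := exists_dyadic_sum_le ha ha
  refine ⟨C, fun I => le_trans (le_of_eq (sum_congr rfl fun i _ => ?_)) (hC 1 one_pos I)⟩
  rw [one_mul, min_eq_left]
  exact Real.rpow_le_rpow_of_exponent_ge (by positivity)
    (pow_le_one₀ (by norm_num) (by norm_num)) (by linarith)

/-- The bound for a level set of height `L` and size `N` in terms of powers of `q` and `L`. -/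
theorem level_le_of_trichotomy {q L N r : ℝ} {k : ℕ} (hq : 0 < q) (hL : 0 < L)
    (h0 : L ^ 2 * N ≤ q)
    (h : L ^ 2 * N ≤ 3 ∨ q ^ k * L ^ 4 * N ≤ 36 ∨ q ^ k * L ^ 8 * N ^ 3 ≤ 1296 * q ^ 2) :
    N * L ^ r ≤ 36 * (L ^ (r - 2) + min (q * L ^ (r - 2)) (q ^ (-(k : ℝ)) * L ^ (r - 4)) +
      min (q * L ^ (r - 2)) (q ^ ((2 - k : ℝ) / 3) * L ^ (r - 8 / 3))) := by
  have hr2 : L ^ r = L ^ 2 * L ^ (r - 2) := by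
    rw [← Real.rpow_natCast, ← Real.rpow_add hL]
    congr 1
    push_cast
    ring
  have ha : N * L ^ r ≤ q * L ^ (r - 2) := by
    rw [hr2, ← mul_assoc, mul_comm N]
    gcongr
  have p1 : 0 < L ^ (r - 2) := by positivity
  have p2 : 0 < q * L ^ (r - 2) := by positivity
  have p3 : 0 < q ^ (-(k : ℝ)) * L ^ (r - 4) := by positivity
  have p4 : 0 < q ^ ((2 - k : ℝ) / 3) * L ^ (r - 8 / 3) := by positivity
  have m1 := lt_min p2 p3
  have m2 := lt_min p2 p4
  rcases h with h | h | h
  · have : N * L ^ r ≤ 3 * L ^ (r - 2) := by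
      rw [hr2, ← mul_assoc, mul_comm N]
      gcongr
    linarith
  · have h1 : N * L ^ r ≤ 36 * (q ^ (-(k : ℝ)) * L ^ (r - 4)) := by
      have hr4 : L ^ r = L ^ 4 * L ^ (r - 4) := by
        rw [← Real.rpow_natCast, ← Real.rpow_add hL]
        congr 1
        push_cast
        ring
      have hqk : q ^ (-(k : ℝ)) * q ^ k = 1 := by
        rw [← Real.rpow_natCast, ← Real.rpow_add hq]
        simp
      calc N * L ^ r = (q ^ k * L ^ 4 * N) * (q ^ (-(k : ℝ)) * L ^ (r - 4)) := by
            rw [hr4]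
            linear_combination (-(N * L ^ 4 * L ^ (r - 4))) * hqk
        _ ≤ _ := by gcongr
    have h2 : N * L ^ r ≤ 36 * min (q * L ^ (r - 2)) (q ^ (-(k : ℝ)) * L ^ (r - 4)) := by
      rw [mul_min_of_nonneg _ _ (by norm_num)]
      exact le_min (by linarith) h1
    linarith
  · have h1 : N * L ^ r ≤ 36 * (q ^ ((2 - k : ℝ) / 3) * L ^ (r - 8 / 3)) := by
      refine le_of_pow_le_pow_left₀ (n := 3) (by norm_num) (by positivity) ?_
      have e1 : (L ^ r) ^ 3 = L ^ 8 * (L ^ (r - 8 / 3)) ^ 3 := by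
        rw [← Real.rpow_natCast, ← Real.rpow_natCast, ← Real.rpow_natCast, ← Real.rpow_mul hL.le,
          ← Real.rpow_mul hL.le, ← Real.rpow_add hL]
        congr 1
        push_cast
        ring
      have e2 : q ^ k * (q ^ ((2 - k : ℝ) / 3)) ^ 3 = q ^ 2 := by
        rw [← Real.rpow_natCast, ← Real.rpow_natCast, ← Real.rpow_natCast, ← Real.rpow_mul hq.le,
          ← Real.rpow_add hq]
        congr 1
        push_cast
        ring
      refine le_of_mul_le_mul_left (a := q ^ k) ?_ (by positivity)
      calc q ^ k * (N * L ^ r) ^ 3 = (q ^ k * L ^ 8 * N ^ 3) * (L ^ (r - 8 / 3)) ^ 3 := by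
            rw [mul_pow, e1]
            ring
        _ ≤ (1296 * q ^ 2) * (L ^ (r - 8 / 3)) ^ 3 := by gcongr
        _ ≤ (36 ^ 3 * q ^ 2) * (L ^ (r - 8 / 3)) ^ 3 := by gcongr; norm_num
        _ = _ := by
            rw [← e2]
            ring
    have h2 : N * L ^ r ≤ 36 * min (q * L ^ (r - 2))
        (q ^ ((2 - k : ℝ) / 3) * L ^ (r - 8 / 3)) := by
      rw [mul_min_of_nonneg _ _ (by norm_num)]
      exact le_min (by linarith) h1
    linarith

/-- Brings a bound into the form `(t L)^β` required by the dyadic sum, with the peak at `L =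
q^(-α)`. -/
theorem rpow_mul_rpow_eq {q L : ℝ} (hq : 0 < q) (hL : 0 < L) {α β γ : ℝ} (h : α * β = γ) :
    q ^ γ * L ^ β = (q ^ α * L) ^ β := by
  rw [Real.mul_rpow (by positivity) hL.le, ← Real.rpow_mul hq.le, h]

end DyadicSums

/-! ### The three ranges of dimension -/

section Theorem

universe u

/-- For `k = 1` the third alternative gives `q^(1/3) L^(r - 8/3)`, which is worst for large `L`.
Stein–Tomas restricts it to `L` at most about `q^(-3/4)`, and `1/3 = (3/4)(r - 8/3)` gives `r =
28/9`. -/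
theorem extensionConst_four :
    ∃ C : ℝ≥0, ∀ (F : Type u) [Field F] [Fintype F], ringChar F ≠ 2 →
      ∀ e : AddChar F ℂ, e ≠ 1 → extensionConst e 3 2 (28 / 9) ≤ C := by
  obtain ⟨C₁, h₁⟩ := exists_sum_rpow_le (a := 10 / 9) (by norm_num)
  obtain ⟨C₂, h₂⟩ := exists_dyadic_sum_le (a := 10 / 9) (b := 8 / 9) (by norm_num) (by norm_num)
  obtain ⟨C₃, h₃⟩ := exists_dyadic_sum_le (a := 4 / 9) (b := 4 / 9) (by norm_num) (by norm_num)
  refine ⟨((2 ^ (28 / 9 : ℝ) * (36 * (C₁ + C₂ + 2 * C₃))) ^ (1 / (28 / 9 : ℝ))).toNNReal,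
    fun F _ _ hF e he => ?_⟩
  have hq1 : (1 : ℝ) ≤ Fintype.card F := by exact_mod_cast Fintype.card_pos
  set q : ℝ := (Fintype.card F : ℝ) with hqdef
  have hq : 0 < q := by linarith
  refine extensionConst_le_of_level_bound (by norm_num) (fun i =>
    36 * (((1 / 2 : ℝ) ^ (i + 1)) ^ (10 / 9 : ℝ) +
      min ((q ^ (9 / 10 : ℝ) * (1 / 2) ^ (i + 1)) ^ (10 / 9 : ℝ))
        ((q ^ (9 / 10 : ℝ) * (1 / 2) ^ (i + 1)) ^ (-(8 / 9) : ℝ)) +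
      2 * min ((q ^ (3 / 4 : ℝ) * (1 / 2) ^ (i + 1)) ^ (4 / 9 : ℝ))
        ((q ^ (3 / 4 : ℝ) * (1 / 2) ^ (i + 1)) ^ (-(4 / 9) : ℝ)))) (fun I => ?_) ?_
    (fun i => by positivity)
  · rw [← mul_sum, sum_add_distrib, sum_add_distrib, ← mul_sum]
    gcongr
    · exact h₁ I
    · exact h₂ _ (by positivity) I
    · exact h₃ _ (by positivity) I
  intro i G g hG hg h
  have ht := level_trichotomy hF he (k := 1) (by norm_num) hG hg h
  have hc := level_mul_card_le he hG hg h
  have hd := level_dichotomy hF he hG hg h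
  rw [← hqdef] at ht hc hd
  set L : ℝ := (1 / 2) ^ (i + 1) with hLdef
  have hL : 0 < L := by positivity
  have p1 : 0 < L ^ (10 / 9 : ℝ) := by positivity
  have p2 : 0 < min ((q ^ (9 / 10 : ℝ) * L) ^ (10 / 9 : ℝ))
      ((q ^ (9 / 10 : ℝ) * L) ^ (-(8 / 9) : ℝ)) := by positivity
  have p3 : 0 < min ((q ^ (3 / 4 : ℝ) * L) ^ (4 / 9 : ℝ))
      ((q ^ (3 / 4 : ℝ) * L) ^ (-(4 / 9) : ℝ)) := by positivity
  rcases hd with hd | hd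
  · have h1 : #G * L ^ (28 / 9 : ℝ) ≤ 2 * L ^ (10 / 9 : ℝ) := by
      have h2 : L ^ (28 / 9 : ℝ) = L ^ 2 * L ^ (10 / 9 : ℝ) := by
        rw [← Real.rpow_natCast, ← Real.rpow_add hL]
        norm_num
      rw [h2, ← mul_assoc, mul_comm (#G : ℝ)]
      gcongr
    linarith
  refine (level_le_of_trichotomy (r := 28 / 9) hq hL hc ht).trans ?_
  gcongr ?_ * (?_ + min ?_ ?_ + ?_)
  · norm_num
  · rw [← rpow_mul_rpow_eq hq hL (γ := 1) (by norm_num), Real.rpow_one]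
    norm_num
  -- The factor `9/10` is dictated by the other branch of the minimum; here it needs only
  -- `q^(-4/5)`, weaker than the available `q^(-1)`.
  · rw [← rpow_mul_rpow_eq hq hL (γ := -(4 / 5)) (by norm_num),
      show (28 / 9 - 4 : ℝ) = -(8 / 9) by norm_num]
    exact mul_le_mul_of_nonneg_right (Real.rpow_le_rpow_of_exponent_le hq1 (by norm_num))
      (by positivity)
  -- The Stein–Tomas cap reads `u^4 ≤ 4`, so `u ≤ 2` and `u^(8/9) ≤ 2`. Thus `u^(4/9)` is at most
  -- twice the two-sided minimum.
  · set u := q ^ (3 / 4 : ℝ) * L with hu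
    have hu0 : 0 < u := by positivity
    have hu2 : u ≤ 2 := by
      refine le_of_pow_le_pow_left₀ (n := 4) (by norm_num) (by norm_num) ?_
      have : u ^ 4 = q ^ 3 * L ^ 4 := by
        rw [hu, mul_pow, ← Real.rpow_mul_natCast hq.le]
        norm_num
      rw [this]
      linarith
    have h1 : q ^ ((2 - (1 : ℕ) : ℝ) / 3) * L ^ (28 / 9 - 8 / 3 : ℝ) = u ^ (4 / 9 : ℝ) := by
      rw [hu, ← rpow_mul_rpow_eq hq hL (γ := 1 / 3) (by norm_num)]
      norm_num
    refine (min_le_right _ _).trans ?_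
    rw [h1, mul_min_of_nonneg _ _ (by norm_num)]
    refine le_min (by linarith [Real.rpow_nonneg hu0.le (4 / 9)]) ?_
    rw [Real.rpow_neg hu0.le, ← div_eq_mul_inv, le_div_iff₀ (by positivity), ← Real.rpow_add hu0]
    calc u ^ (4 / 9 + 4 / 9 : ℝ) ≤ 2 ^ (4 / 9 + 4 / 9 : ℝ) := by gcongr
      _ ≤ 2 ^ (1 : ℝ) := by gcongr <;> norm_num
      _ = 2 := by norm_num

/-- For `k = 2` the third alternative bounds `N L^(8/3)` by a constant, with no decay in either
direction; the extra `L^ε` makes the sum over heights converge. -/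
theorem extensionConst_six {ε : ℝ} (hε : 0 < ε) :
    ∃ C : ℝ≥0, ∀ (F : Type u) [Field F] [Fintype F], ringChar F ≠ 2 →
      ∀ e : AddChar F ℂ, e ≠ 1 → extensionConst e 5 2 (8 / 3 + ε) ≤ C := by
  obtain ⟨C₁, h₁⟩ := exists_sum_rpow_le (a := 2 / 3 + ε) (by positivity)
  obtain ⟨C₂, h₂⟩ := exists_dyadic_sum_le (a := 2 / 3) (b := 4 / 3) (by norm_num) (by norm_num)
  obtain ⟨C₃, h₃⟩ := exists_sum_rpow_le hε
  refine ⟨((2 ^ (8 / 3 + ε) * (36 * (C₁ + C₂ + C₃))) ^ (1 / (8 / 3 + ε))).toNNReal,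
    fun F _ _ hF e he => ?_⟩
  have hq1 : (1 : ℝ) ≤ Fintype.card F := by exact_mod_cast Fintype.card_pos
  set q : ℝ := (Fintype.card F : ℝ) with hqdef
  have hq : 0 < q := by linarith
  refine extensionConst_le_of_level_bound (by positivity) (fun i =>
    36 * (((1 / 2 : ℝ) ^ (i + 1)) ^ (2 / 3 + ε) +
      min ((q ^ (3 / 2 : ℝ) * (1 / 2) ^ (i + 1)) ^ (2 / 3 : ℝ))
        ((q ^ (3 / 2 : ℝ) * (1 / 2) ^ (i + 1)) ^ (-(4 / 3) : ℝ)) +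
      ((1 / 2 : ℝ) ^ (i + 1)) ^ ε)) (fun I => ?_) ?_
    (fun i => by positivity)
  · rw [← mul_sum, sum_add_distrib, sum_add_distrib]
    gcongr
    · exact h₁ I
    · exact h₂ _ (by positivity) I
    · exact h₃ I
  intro i G g hG hg h
  have ht := level_trichotomy hF he (k := 2) (by norm_num) hG hg h
  have hc := level_mul_card_le he hG hg h
  rw [← hqdef] at ht hc
  set L : ℝ := (1 / 2) ^ (i + 1) with hLdef
  have hL : 0 < L := by positivity
  have hL1 : L ≤ 1 := pow_le_one₀ (by norm_num) (by norm_num)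
  refine (level_le_of_trichotomy (r := 8 / 3 + ε) hq hL hc ht).trans ?_
  have hmono : ∀ x : ℝ, L ^ (x + ε) ≤ L ^ x := fun x =>
    Real.rpow_le_rpow_of_exponent_ge hL hL1 (by linarith)
  gcongr ?_ * (?_ + min ?_ ?_ + ?_)
  · rw [show 8 / 3 + ε - 2 = 2 / 3 + ε by ring]
  · rw [show 8 / 3 + ε - 2 = 2 / 3 + ε by ring, ← rpow_mul_rpow_eq hq hL (γ := 1) (by norm_num),
      Real.rpow_one]
    exact mul_le_mul_of_nonneg_left (hmono _) (by positivity)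
  · rw [show 8 / 3 + ε - 4 = -(4 / 3) + ε by ring,
      ← rpow_mul_rpow_eq hq hL (γ := -((2 : ℕ) : ℝ)) (by norm_num)]
    exact mul_le_mul_of_nonneg_left (hmono _) (by positivity)
  · refine (min_le_right _ _).trans (le_of_eq ?_)
    norm_num

/-- Both minima peak at `L = q^(-(k+1)/2)`, with value 1 at this `r`. The decay exponent `(2k -
4)/(3(k + 1))` above the peak is positive because `k > 2`. -/
theorem extensionConst_ge_eight {k : ℕ} (hk : 3 ≤ k) :
    ∃ C : ℝ≥0, ∀ (F : Type u) [Field F] [Fintype F], ringChar F ≠ 2 →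
      ∀ e : AddChar F ℂ, e ≠ 1 → extensionConst e (2 * k + 1) 2 (2 + 2 / (k + 1)) ≤ C := by
  have hk3 : (3 : ℝ) ≤ k := by exact_mod_cast hk
  have hk1 : (k : ℝ) + 1 ≠ 0 := by positivity
  obtain ⟨C₁, h₁⟩ := exists_sum_rpow_le (a := 2 / (k + 1)) (by positivity)
  obtain ⟨C₂, h₂⟩ := exists_dyadic_sum_le (a := 2 / (k + 1)) (b := 2 * k / (k + 1))
    (by positivity) (by positivity)
  obtain ⟨C₃, h₃⟩ := exists_dyadic_sum_le (a := 2 / (k + 1)) (b := (2 * k - 4) / (3 * (k + 1)))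
    (by positivity) (div_pos (by linarith) (by positivity))
  refine ⟨((2 ^ (2 + 2 / (k + 1) : ℝ) * (36 * (C₁ + C₂ + C₃))) ^
    (1 / (2 + 2 / (k + 1) : ℝ))).toNNReal, fun F _ _ hF e he => ?_⟩
  have hq1 : (1 : ℝ) ≤ Fintype.card F := by exact_mod_cast Fintype.card_pos
  set q : ℝ := (Fintype.card F : ℝ) with hqdef
  have hq : 0 < q := by linarith
  refine extensionConst_le_of_level_bound (by positivity) (fun i =>
    36 * (((1 / 2 : ℝ) ^ (i + 1)) ^ (2 / (k + 1) : ℝ) +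
      min ((q ^ ((k + 1) / 2 : ℝ) * (1 / 2) ^ (i + 1)) ^ (2 / (k + 1) : ℝ))
        ((q ^ ((k + 1) / 2 : ℝ) * (1 / 2) ^ (i + 1)) ^ (-(2 * k / (k + 1)) : ℝ)) +
      min ((q ^ ((k + 1) / 2 : ℝ) * (1 / 2) ^ (i + 1)) ^ (2 / (k + 1) : ℝ))
        ((q ^ ((k + 1) / 2 : ℝ) * (1 / 2) ^ (i + 1)) ^ (-((2 * k - 4) / (3 * (k + 1))) : ℝ))))
    (fun I => ?_) ?_ (fun i => by positivity)
  · rw [← mul_sum, sum_add_distrib, sum_add_distrib]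
    gcongr
    · exact h₁ I
    · exact h₂ _ (by positivity) I
    · exact h₃ _ (by positivity) I
  intro i G g hG hg h
  have ht := level_trichotomy hF he rfl hG hg h
  have hc := level_mul_card_le he hG hg h
  rw [← hqdef] at ht hc
  set L : ℝ := (1 / 2) ^ (i + 1) with hLdef
  have hL : 0 < L := by positivity
  refine (level_le_of_trichotomy (r := 2 + 2 / (k + 1)) hq hL hc ht).trans
    (le_of_eq ?_)
  have e1 : (2 : ℝ) + 2 / (k + 1) - 2 = 2 / (k + 1) := by ring
  have e2 : (2 : ℝ) + 2 / (k + 1) - 4 = -(2 * k / (k + 1)) := by field_simp; ring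
  have e3 : (2 : ℝ) + 2 / (k + 1) - 8 / 3 = -((2 * k - 4) / (3 * (k + 1))) := by field_simp; ring
  rw [e1, e2, e3, ← rpow_mul_rpow_eq hq hL (α := (k + 1) / 2) (β := 2 / (k + 1)) (γ := 1)
      (by field_simp),
    ← rpow_mul_rpow_eq hq hL (α := (k + 1) / 2) (β := -(2 * k / (k + 1))) (γ := -(k : ℝ))
      (by field_simp),
    ← rpow_mul_rpow_eq hq hL (α := (k + 1) / 2) (β := -((2 * k - 4) / (3 * (k + 1))))
      (γ := (2 - k) / 3) (by field_simp; ring), Real.rpow_one]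

end Theorem

end FiniteFieldRestriction

theorem theorem1 :
    -- dimension `d = 4`, where `F ^ d` is `Fin (3 + 1) → F`
    (∃ C : ℝ≥0, ∀ (F : Type*) [Field F] [Fintype F], ringChar F ≠ 2 →
      ∀ e : AddChar F ℂ, e ≠ 1 →
        FiniteFieldRestriction.extensionConst e 3 2 (28 / 9) ≤ C) ∧
    -- dimension `d = 6`, where `F ^ d` is `Fin (5 + 1) → F`
    (∀ ε : ℝ, 0 < ε → ∃ C : ℝ≥0, ∀ (F : Type*) [Field F] [Fintype F], ringChar F ≠ 2 →
      ∀ e : AddChar F ℂ, e ≠ 1 →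
        FiniteFieldRestriction.extensionConst e 5 2 (8 / 3 + ε) ≤ C) ∧
    -- even dimensions `d = n + 1 ≥ 8`
    (∀ n d : ℕ, d = n + 1 → Even d → 8 ≤ d →
      ∃ C : ℝ≥0, ∀ (F : Type*) [Field F] [Fintype F], ringChar F ≠ 2 →
        ∀ e : AddChar F ℂ, e ≠ 1 →
          FiniteFieldRestriction.extensionConst e n 2 ((2 * d + 4) / d) ≤ C) := by
  refine ⟨FiniteFieldRestriction.extensionConst_four,
    fun ε hε => FiniteFieldRestriction.extensionConst_six hε, ?_⟩
  rintro n d hd ⟨j, hj⟩ hd8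
  obtain ⟨k, rfl⟩ : ∃ k, j = k + 1 := ⟨j - 1, by omega⟩
  obtain rfl : n = 2 * k + 1 := by omega
  have he : (2 * d + 4 : ℝ) / d = 2 + 2 / (k + 1) := by
    have : (k : ℝ) + 1 ≠ 0 := by positivity
    rw [hj]
    push_cast
    field_simp
    ring
  rw [he]
  exact FiniteFieldRestriction.extensionConst_ge_eight (by omega)
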